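/- **Setting.** Let $M_0=\mathbb Z[X]$ be the free abelian group with basis $b_i=X^i$ ($i\ge 0$). Let $r\ge 1$ and $n\ge 0$ be integers. Let $\mathcal P_{r,n}$ be the set of partitions $\lambda=(\lambda_1\ge\dots\ge\lambda_r\ge 0)$ with $\lambda_1\le n-r$ (empty if $n<r$), and put $[\mathbf b]^r_\lambda=b_{\lambda_r}\wedge b_{1+\lambda_{r-1}}\wedge\dots\wedge b_{r-1+\lambda_1}\in\bigwedge^rM_0$. A tensor in $\bigwedge^rM_0$ is *decomposable* if it equals $m_1\wedge\dots\wedge m_r$ for some $m_1,\dots,m_r\in M_0$. For $s\ge 0$ let $B_s=\mathbb Z[e_1,\dots,e_s]$ and $E_s(z)=1-e_1z+\dots+(-1)^se_sz^s$, and let $H_s=(h_j)_{j\in\mathbb Z}$ be defined by $\sum_{j\in\mathbb Z} h_jz^j=1/E_s(z)\in B_s[[z]]$ (so $h_j=0$ for $j<0$ and $h_0=1$). For a bilateral sequence $G=(g_j)_{j\in\mathbb Z}$ in a commutative ring and a partition $\lambda=(\lambda_1,\dots,\lambda_t)$ let $\Delta_\lambda(G)=\det(g_{\lambda_j-j+i})_{1\le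 i,j\le t}$. The map $\phi_s:B_s\to\bigwedge^sM_0$, $\Delta_\lambda(H_s)\mapsto[\mathbf b]^s_\lambda$ ($\lambda=(\lambda_1\ge\dots\ge\lambda_s\ge0)$), is an isomorphism of abelian groups. Let $\sigma_-(z),\overline\sigma_-(z):\bigwedge M_0\to(\bigwedge M_0)[z^{-1}]$ be the unique maps multiplicative for $\wedge$ (Hasse–Schmidt derivations) with $\sigma_-(z)b_j=\sum_{i=0}^jb_{j-i}z^{-i}$ and $\overline\sigma_-(z)b_j=b_j-b_{j-1}z^{-1}$ ($b_{-1}=0$); they are inverse to each other. Through $\phi_s$ they induce maps $\sigma_-(z),\overline\sigma_-(z):B_s\to B_s[z^{-1}]$. Put $\sigma_-(z)H_s=(\sigma_-(z)h_j)_{j}$ and $\overline\sigma_-(z)H_s=(\overline\sigma_-(z)h_j)_{j}$; for $s=0$ the $j$-th term of $\sigma_-(z)H_0$ is by convention $z^{-j}$ if $j\ge0$ and $0$ if $j<0$. Let $B_{s,n}=B_s/(h_{n-s+1},\dots,h_n)$, where the generators are terms of $H_s$; thus $B_{r-1,n}=B_{r-1}/(h_{n-r+2},\dots,h_n)$ and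 $B_{r+1,n}=B_{r+1}/(h_{n-r},\dots,h_n)$. Write $\sigma_-(z)H_{s,n}$, $\overline\sigma_-(z)H_{s,n}$ for the termwise images of $\sigma_-(z)H_s$, $\overline\sigma_-(z)H_s$ in $B_{s,n}((z))$, write $\overline\sigma_-(z)\Delta_\mu(H_{s,n})$ for the image of $\overline\sigma_-(z)\Delta_\mu(H_s)$ in $B_{s,n}((z))$, and write $E_s(z)$, $1/E_s(z)$ also for their images in $B_{s,n}((z))$. For sequences attached to $s=r+1$, a partition $\mu\in\mathcal P_{r,n}$ is read as $(\mu_1,\dots,\mu_r,0)$. Let $\mathrm{Res}_z$ be the coefficient of $z^{-1}$. **Corollary.** Let $(a_\lambda)_{\lambda\in\mathcal P_{r,n}}$ be integers. The following are equivalent. 1. The tensor $\sum_{\lambda\in\mathcal P_{r,n}}a_\lambda[\mathbf b]^r_\lambda\in\bigwedge^rM_0$ is decomposable. 2. In $(B_{r-1,n}\otimes_{\mathbb Z}B_{r+1,n})((z))$, $$\mathrm{Res}_z\sum_{\lambda,\mu\in\mathcal P_{r,n}}a_\lambda a_\mu\,E_{r-1}(z)\Delta_\lambda(\sigma_-(z)H_{r-1,n})\otimes\frac1{E_{r+1}(z)}\Delta_\mu(\overline\sigma_-(z)H_{r+1,n})=0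 .$$ 3. Marking with $'$ and $''$ the images in $(B_{r-1,n}\otimes_{\mathbb Z}B_{r+1,n})((z))$ of elements of $B_{r-1,n}((z))$ and $B_{r+1,n}((z))$ respectively, $$\mathrm{Res}_z\,\frac{E'_{r-1}(z)}{E''_{r+1}(z)}\sum_{\lambda,\mu\in\mathcal P_{r,n}}a_\lambda a_\mu\,\Delta_\lambda(\sigma_-(z)H'_{r-1,n})\cdot\overline\sigma_-(z)\Delta_\mu(H''_{r+1,n})=0 .$$ -/

import Mathlib

open scoped TensorProduct

namespace SchubertDerivation

noncomputable section

/-! ### The free abelian group `M₀ = ℤ[X]` and its exterior algebra -/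

/-- The free abelian group `M₀ = ℤ[X]`, with basis `b_i = X ^ i`. -/
abbrev M0 : Type := Polynomial ℤ

/-- The basis element `b_i = X ^ i` of `M₀`. -/
def b (i : ℕ) : M0 := Polynomial.X ^ i

/-- The exterior algebra `⋀ M₀`. -/
abbrev Ext : Type := ExteriorAlgebra ℤ M0

/-- The polynomials in `(⋀ M₀)[w]` all of whose coefficients lie in `M₀ ⊆ ⋀ M₀`. -/
def degOne : Submodule ℤ (Polynomial Ext) where
  carrier := {p | ∀ i, p.coeff i ∈ LinearMap.range (ExteriorAlgebra.ι ℤ : M0 →ₗ[ℤ] Ext)}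
  add_mem' {p q} hp hq i := by
    rw [Polynomial.coeff_add]; exact Submodule.add_mem _ (hp i) (hq i)
  zero_mem' i := by
    rw [Polynomial.coeff_zero]; exact Submodule.zero_mem _
  smul_mem' c p hp i := by
    rw [Polynomial.coeff_smul]; exact Submodule.smul_mem _ c (hp i)

theorem degOne_mul_self {p : Polynomial Ext} (hp : p ∈ degOne) : p * p = 0 := by
  ext n
  rw [Polynomial.coeff_mul, Polynomial.coeff_zero]
  refine Finset.sum_involution (fun x _ => x.swap) ?_ ?_ ?_ ?_
  · rintro ⟨i, j⟩ _
    obtain ⟨u, hu⟩ := hp i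
    obtain ⟨v, hv⟩ := hp j
    simp only [Prod.fst_swap, Prod.snd_swap, ← hu, ← hv]
    exact ExteriorAlgebra.ι_add_mul_swap u v
  · rintro ⟨i, j⟩ _ hne heq
    have hij : j = i := congrArg Prod.fst heq
    subst hij
    obtain ⟨u, hu⟩ := hp j
    apply hne
    simp only [← hu]
    exact ExteriorAlgebra.ι_sq_zero u
  · rintro ⟨i, j⟩ h
    simpa [add_comm] using h
  · rintro ⟨i, j⟩ _
    rfl

/-- The linear map `M₀ → (⋀ M₀)[w]` with `b_j ↦ f j`. -/
def genMap (f : ℕ → Polynomial Ext) : M0 →ₗ[ℤ] Polynomial Ext :=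
  (Polynomial.basisMonomials ℤ).constr ℤ f

theorem genMap_mem (f : ℕ → Polynomial Ext) (hf : ∀ j, f j ∈ degOne) (m : M0) :
    genMap f m ∈ degOne := by
  rw [genMap, Module.Basis.constr_apply]
  exact Submodule.sum_mem _ fun j _ => Submodule.smul_mem _ _ (hf j)

/-- The unique Hasse–Schmidt derivation (multiplicative map) `⋀ M₀ → (⋀ M₀)[w]`
with `b_j ↦ f j`. The variable `w` stands for `z⁻¹`. -/
def hsDerivation (f : ℕ → Polynomial Ext) (hf : ∀ j, f j ∈ degOne) :
    Ext →ₐ[ℤ] Polynomial Ext :=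
  ExteriorAlgebra.lift ℤ ⟨genMap f, fun m => degOne_mul_self (genMap_mem f hf m)⟩

theorem monomial_mem_degOne (i : ℕ) (m : M0) :
    Polynomial.monomial i (ExteriorAlgebra.ι ℤ m) ∈ degOne := by
  intro k
  rw [Polynomial.coeff_monomial]
  split_ifs
  · exact ⟨m, rfl⟩
  · exact Submodule.zero_mem _

/-- The values `σ₋(z) b_j = ∑_{i ≤ j} b_{j-i} z⁻ⁱ`. -/
def sigmaGen (j : ℕ) : Polynomial Ext :=
  ∑ i ∈ Finset.range (j + 1), Polynomial.monomial i (ExteriorAlgebra.ι ℤ (b (j - i)))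

/-- The values `σ̄₋(z) b_j = b_j - b_{j-1} z⁻¹`, where `b_{-1} = 0`. -/
def sigmaBarGen (j : ℕ) : Polynomial Ext :=
  Polynomial.monomial 0 (ExteriorAlgebra.ι ℤ (b j)) -
    if j = 0 then 0 else Polynomial.monomial 1 (ExteriorAlgebra.ι ℤ (b (j - 1)))

theorem sigmaGen_mem (j : ℕ) : sigmaGen j ∈ degOne :=
  Submodule.sum_mem _ fun _ _ => monomial_mem_degOne _ _

theorem sigmaBarGen_mem (j : ℕ) : sigmaBarGen j ∈ degOne := by
  refine Submodule.sub_mem _ (monomial_mem_degOne _ _) ?_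
  split_ifs
  · exact Submodule.zero_mem _
  · exact monomial_mem_degOne _ _

/-- The Schubert derivation `σ₋(z) : ⋀ M₀ → (⋀ M₀)[z⁻¹]`. -/
def sigmaMinus : Ext →ₐ[ℤ] Polynomial Ext := hsDerivation sigmaGen sigmaGen_mem

/-- The inverse Schubert derivation `σ̄₋(z) : ⋀ M₀ → (⋀ M₀)[z⁻¹]`. -/
def sigmaBarMinus : Ext →ₐ[ℤ] Polynomial Ext := hsDerivation sigmaBarGen sigmaBarGen_mem

/-! ### Partitions, the basis of `⋀ʳ M₀`, decomposable tensors -/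

/-- The set `𝒫_{r,n}` of partitions `λ₁ ≥ … ≥ λ_r ≥ 0` with `λ₁ ≤ n - r` (as integers, so it is
empty if `n < r`). The entry `λ_{i+1}` is `lam i`. -/
def boundedPartitions (r n : ℕ) : Finset (Fin r → ℕ) :=
  open Classical in
  (Fintype.piFinset fun _ => Finset.range (n + 1)).filter
    fun lam => Antitone lam ∧ ∀ i, lam i + r ≤ n

/-- The basis element `[b]^r_λ = b_{λ_r} ∧ b_{1+λ_{r-1}} ∧ ⋯ ∧ b_{r-1+λ₁}` of `⋀ʳ M₀`. -/
def wedge {r : ℕ} (lam : Fin r → ℕ) : ⋀[ℤ]^r M0 :=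
  exteriorPower.ιMulti ℤ r fun k : Fin r => b (k + lam k.rev)

/-- Membership in the Grassmann cone: `m = m₁ ∧ ⋯ ∧ m_r` for some `m_i ∈ M₀`. -/
def IsDecomposable {r : ℕ} (m : ⋀[ℤ]^r M0) : Prop :=
  ∃ v : Fin r → M0, exteriorPower.ιMulti ℤ r v = m

/-! ### The polynomial ring `B_r` -/

/-- `B_r = ℤ[e_1, …, e_r]`; the indeterminate `e_{i+1}` is `MvPolynomial.X i`. -/
abbrev B (r : ℕ) : Type := MvPolynomial (Fin r) ℤ

/-- `E_r(z) = 1 - e_1 z + ⋯ + (-1)^r e_r z^r`, as a power series. -/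
def E (r : ℕ) : PowerSeries (B r) :=
  1 + ∑ i : Fin r, PowerSeries.monomial (i + 1) ((-1) ^ (i + 1 : ℕ) * MvPolynomial.X i)

/-- The inverse `1 / E_r(z)` in `B_r[[z]]`. -/
def invE (r : ℕ) : PowerSeries (B r) := PowerSeries.invOfUnit (E r) 1

theorem E_mul_invE (r : ℕ) : E r * invE r = 1 := by
  apply PowerSeries.mul_invOfUnit
  rw [← PowerSeries.coeff_zero_eq_constantCoeff_apply, E, map_add, map_sum]
  rw [Finset.sum_eq_zero fun i _ => by rw [PowerSeries.coeff_monomial, if_neg (by omega)]]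
  simp

/-- The bilateral sequence `H_r = (h_j)_{j ∈ ℤ}`, with `∑ h_j z^j = 1 / E_r(z)`. -/
def h (r : ℕ) (j : ℤ) : B r := if j < 0 then 0 else PowerSeries.coeff j.toNat (invE r)

/-- The Schur determinant `Δ_λ(g) = det (g_{λ_j - j + i})_{1 ≤ i, j ≤ s}` of a bilateral sequence
`g` and of `λ = (λ₁, …, λ_s)`. -/
def schurDet {R : Type*} [CommRing R] {s : ℕ} (lam : Fin s → ℕ) (g : ℤ → R) : R :=
  Matrix.det (Matrix.of fun i j : Fin s => g ((lam j : ℤ) - (j : ℤ) + (i : ℤ)))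

/-- The linear map `M₀ → B_r^r` given by `b_c ↦ (h_c, h_{c-1}, …, h_{c-r+1})`. -/
def hRow (r : ℕ) : M0 →ₗ[ℤ] (Fin r → B r) :=
  (Polynomial.basisMonomials ℤ).constr ℤ fun c => fun l : Fin r => h r ((c : ℤ) - (l : ℤ))

/-- The alternating map sending `(m_1, …, m_r)` to the determinant with rows `hRow r m_i`. -/
def hAlt (r : ℕ) : M0 [⋀^Fin r]→ₗ[ℤ] B r :=
  { ((Matrix.detRowAlternating (n := Fin r)
      (R := B r)).toMultilinearMap.restrictScalars ℤ).compLinearMap (fun _ => hRow r) with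
    map_eq_zero_of_eq' := fun v _ _ hv hij =>
      Matrix.detRowAlternating.map_eq_zero_of_eq (fun k => hRow r (v k))
        (congrArg (hRow r) hv) hij }

/-- The inverse of the isomorphism `φ_r : B_r → ⋀ʳ M₀`, extended by zero to the components of
`⋀ M₀` of degree different from `r`: it maps `m_1 ∧ ⋯ ∧ m_r` to the determinant of the matrix
with rows `hRow r m_i`, hence `[b]^r_λ` to `Δ_λ(H_r)`, see `phiInv_wedge`. -/
def phiInv (r : ℕ) : Ext →ₗ[ℤ] B r :=
  ExteriorAlgebra.liftAlternating
    (Pi.single (M := fun i => M0 [⋀^Fin i]→ₗ[ℤ] B r) r (hAlt r))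

theorem phiInv_wedge {r : ℕ} (lam : Fin r → ℕ) :
    phiInv r (wedge lam : Ext) = schurDet lam (h r) := by
  have key : ∀ c : ℕ, hRow r (b c) = fun l : Fin r => h r ((c : ℤ) - (l : ℤ)) := by
    intro c
    have hb : b c = Polynomial.basisMonomials ℤ c := by
      simp [b, Polynomial.X_pow_eq_monomial]
    rw [hb, hRow, Module.Basis.constr_basis]
  rw [wedge, exteriorPower.ιMulti_apply_coe, phiInv, ExteriorAlgebra.liftAlternating_apply_ιMulti,
    Pi.single_eq_same, schurDet]
  change Matrix.det (Matrix.of fun k : Fin r => hRow r (b (k + lam k.rev))) = _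
  rw [← Matrix.det_transpose, ← Matrix.det_submatrix_equiv_self (Fin.revPerm (n := r))]
  congr 1
  ext1 i j
  simp only [Matrix.submatrix_apply, Matrix.transpose_apply, Matrix.of_apply, Fin.revPerm_apply]
  rw [key, Fin.rev_rev]
  refine congrArg (h r) ?_
  have hi := Fin.val_rev i
  have hj := Fin.val_rev j
  have hi' := i.isLt
  have hj' := j.isLt
  simp only [Nat.cast_add]
  omega

/-- The isomorphism of abelian groups `φ_r : B_r → ⋀ʳ M₀` with `Δ_λ(H_r) ↦ [b]^r_λ`: the inverse
of the bijection `⋀ʳ M₀ → B_r`, `[b]^r_λ ↦ Δ_λ(H_r)`. -/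
def phi (r : ℕ) : B r → ⋀[ℤ]^r M0 := Function.invFun fun m : ⋀[ℤ]^r M0 => phiInv r (m : Ext)

/-- For an operator `D : ⋀ M₀ → (⋀ M₀)[z⁻¹]`, the operator `φ_r⁻¹ ∘ D ∘ φ_r : B_r → B_r[z⁻¹]`,
with `φ_r⁻¹` applied coefficientwise. -/
def transport (r : ℕ) (D : Ext →ₐ[ℤ] Polynomial Ext) (p : B r) : Polynomial (B r) :=
  (D (phi r p : Ext)).sum fun i m => Polynomial.monomial i (phiInv r m)

/-- `σ₋(z) : B_r → B_r[z⁻¹]`. -/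
def sigmaMinusB (r : ℕ) : B r → Polynomial (B r) := transport r sigmaMinus

/-- `σ̄₋(z) : B_r → B_r[z⁻¹]`. -/
def sigmaBarMinusB (r : ℕ) : B r → Polynomial (B r) := transport r sigmaBarMinus

/-- The bilateral sequence `σ₋(z) H_r = (σ₋(z) h_j)_{j ∈ ℤ}`. By convention, for `r = 0` the
`j`-th term is `z⁻ʲ` if `j ≥ 0` (and `0` if `j < 0`). -/
def sigmaMinusH (r : ℕ) (j : ℤ) : Polynomial (B r) :=
  if r = 0 then (if j < 0 then 0 else Polynomial.X ^ j.toNat) else sigmaMinusB r (h r j)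

/-- The bilateral sequence `σ̄₋(z) H_r = (σ̄₋(z) h_j)_{j ∈ ℤ}` (used only for `r ≥ 1`). -/
def sigmaBarMinusH (r : ℕ) (j : ℤ) : Polynomial (B r) := sigmaBarMinusB r (h r j)

/-! ### The truncated rings `B_{r,n}` -/

/-- The ideal `I_{r,n} = (h_{n-r+1}, …, h_n)` of `B_r`. -/
def truncIdeal (r n : ℕ) : Ideal (B r) :=
  Ideal.span (h r '' Set.Icc ((n : ℤ) - (r : ℤ) + 1) (n : ℤ))

/-- `B_{r,n} = B_r / (h_{n-r+1}, …, h_n)`. -/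
abbrev BT (r n : ℕ) : Type := B r ⧸ truncIdeal r n

/-- The projection `B_r → B_{r,n}`. -/
def proj (r n : ℕ) : B r →+* BT r n := Ideal.Quotient.mk (truncIdeal r n)

/-- The ring homomorphism `B_r[z⁻¹] → B_{r,n}((z))`: reduction of the coefficients. -/
def toLaurent (r n : ℕ) : Polynomial (B r) →+* LaurentSeries (BT r n) :=
  Polynomial.eval₂RingHom ((HahnSeries.C : BT r n →+* LaurentSeries (BT r n)).comp (proj r n))
    (HahnSeries.single (-1 : ℤ) (1 : BT r n))

/-- The image of `E_r(z)` in `B_{r,n}((z))`. -/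
def ET (r n : ℕ) : LaurentSeries (BT r n) :=
  HahnSeries.ofPowerSeries ℤ (BT r n) (PowerSeries.map (proj r n) (E r))

/-- The image of `1 / E_r(z)` in `B_{r,n}((z))`. -/
def invET (r n : ℕ) : LaurentSeries (BT r n) :=
  HahnSeries.ofPowerSeries ℤ (BT r n) (PowerSeries.map (proj r n) (invE r))

/-- The sequence `σ₋(z) H_{r,n}` in `B_{r,n}((z))`: the classes of the `σ₋(z) h_j`. -/
def sigmaMinusHT (r n : ℕ) (j : ℤ) : LaurentSeries (BT r n) := toLaurent r n (sigmaMinusH r j)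

/-- The sequence `σ̄₋(z) H_{r,n}` in `B_{r,n}((z))`: the classes of the `σ̄₋(z) h_j`. -/
def sigmaBarMinusHT (r n : ℕ) (j : ℤ) : LaurentSeries (BT r n) :=
  toLaurent r n (sigmaBarMinusH r j)

/-- `R((z)) → (R ⊗ S)((z))`, `f ↦ f ⊗ 1` on coefficients. -/
def left (R S : Type*) [CommRing R] [CommRing S] (f : LaurentSeries R) :
    LaurentSeries (R ⊗[ℤ] S) :=
  HahnSeries.map f (Algebra.TensorProduct.includeLeft : R →ₐ[ℤ] R ⊗[ℤ] S)

/-- `S((z)) → (R ⊗ S)((z))`, `g ↦ 1 ⊗ g` on coefficients. -/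
def right (R S : Type*) [CommRing R] [CommRing S] (g : LaurentSeries S) :
    LaurentSeries (R ⊗[ℤ] S) :=
  HahnSeries.map g (Algebra.TensorProduct.includeRight : S →ₐ[ℤ] R ⊗[ℤ] S)

/-- The tensor product `f ⊗ g ∈ (R ⊗ S)((z))` of `f ∈ R((z))` and `g ∈ S((z))`. -/
def tens {R S : Type*} [CommRing R] [CommRing S] (f : LaurentSeries R) (g : LaurentSeries S) :
    LaurentSeries (R ⊗[ℤ] S) :=
  left R S f * right R S g

/-- The residue: the coefficient of `z⁻¹`. -/
def res {R : Type*} [CommRing R] (f : LaurentSeries R) : R := HahnSeries.coeff f (-1)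

/-- A partition `(μ₁, …, μ_r) ∈ 𝒫_r`, seen as `(μ₁, …, μ_r, 0) ∈ 𝒫_{r+1}`. -/
def extend {r : ℕ} (mu : Fin r → ℕ) : Fin (r + 1) → ℕ := Fin.snoc (α := fun _ => ℕ) mu 0

end

end SchubertDerivation

open SchubertDerivation

namespace SchubertDerivation

noncomputable section

/-! Let x = ∑ a_λ [b]_λ and let β_i be the form dual to b_i. The proof rests on the Plücker
criterion: x is decomposable exactly when ∑_i (β_i ⌟ x) ⊗ (b_i ∧ x) vanishes. If x = v_1 ∧ ⋯ ∧ v_r,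
expanding β_i ⌟ x leaves only right factors v_k ∧ x = 0 (`plucker_ιMulti`). Conversely, for x ≠ 0 of
degree at least 2, the relations give a vector w ≠ 0 with w ∧ x = 0. Over ℤ, dividing w by its
content gives v with f(v) = 1 for some form f, so x = v ∧ (f ⌟ x), and f ⌟ x inherits the relations
(`exists_ιMulti_of_plucker`).

The residue is minus this tensor, transported by φ⁻¹. By Laplace expansion, the series ∑ z⁻ⁱ φ⁻¹(β_i
⌟ [b]_λ) is, up to sign, a determinant bordered by a column of powers of z⁻¹, and ∑ zⁱ φ⁻¹(b_i ∧
[b]_μ) is 1/E_{r+1}(z) times one bordered by a row of powers of z. Column operations identify them,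
up to sign and a power of z, with E_{r-1}(z) Δ_λ(σ₋H) and Δ_μ(σ̄₋H)/E_{r+1}(z) (`E_mul_schurDet`,
`invE_mul_schurDet`). Conditions 2 and 3 involve the same series, because σ̄₋ is multiplicative on
the exterior algebra and therefore passes inside Schur determinants (`transport_schurDet`).

Finally, nothing needed is lost in the quotients B_{s,n}. Evaluating the e_i at elementary symmetric
polynomials and multiplying by a Vandermonde-type determinant turns φ⁻¹(b_{c_1} ∧ ⋯ ∧ b_{c_s}) into
an alternant, so coordinates on ⋀ˢ M₀ are monomial coefficients (`coordB_phiInv`). Coordinates with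
all indices below n kill the ideal (h_{n-s+1}, …, h_n) (`coordB_mul_h`), and the tensors in play
have no others. -/

/-- The basis `b_i = X ^ i` of `M₀`. -/
abbrev monoBasis : Module.Basis ℕ ℤ M0 := Polynomial.basisMonomials ℤ

theorem monoBasis_apply (i : ℕ) : monoBasis i = b i := by
  simp [b, Polynomial.X_pow_eq_monomial]

theorem b_eq_monomial (i : ℕ) : b i = Polynomial.monomial i 1 := by
  simp [b, Polynomial.X_pow_eq_monomial]

theorem coeff_b (i j : ℕ) : (b i).coeff j = if j = i then 1 else 0 := by
  rw [b, Polynomial.coeff_X_pow]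

/-- The form `β_i` dual to `b_i`. -/
abbrev beta (i : ℕ) : Module.Dual ℤ M0 := Polynomial.lcoeff ℤ i

/-! ### Contractions -/

/-- The contraction `f ⌟ ·` on `⋀ M₀`. -/
def contract : Module.Dual ℤ M0 →ₗ[ℤ] Ext →ₗ[ℤ] Ext :=
  CliffordAlgebra.contractLeft (Q := (0 : QuadraticForm ℤ M0))

theorem contract_ι_mul (f : Module.Dual ℤ M0) (v : M0) (x : Ext) :
    contract f (ExteriorAlgebra.ι ℤ v * x) = f v • x - ExteriorAlgebra.ι ℤ v * contract f x :=
  CliffordAlgebra.contractLeft_ι_mul _ _ _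

theorem contract_one (f : Module.Dual ℤ M0) : contract f 1 = 0 :=
  CliffordAlgebra.contractLeft_one _ _

theorem contract_contract (f : Module.Dual ℤ M0) (x : Ext) : contract f (contract f x) = 0 :=
  CliffordAlgebra.contractLeft_contractLeft _ _

theorem contract_comm (f g : Module.Dual ℤ M0) (x : Ext) :
    contract f (contract g x) = -contract g (contract f x) :=
  CliffordAlgebra.contractLeft_comm _ _ _

/-- Iterated antiderivation rule: the sign counts the vectors that f passes before reaching v_k. -/
theorem contract_ιMulti (f : Module.Dual ℤ M0) {s : ℕ} (v : Fin (s + 1) → M0) :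
    contract f (ExteriorAlgebra.ιMulti ℤ (s + 1) v) =
      ∑ k : Fin (s + 1), ((-1) ^ (k : ℕ) * f (v k)) •
        ExteriorAlgebra.ιMulti ℤ s (fun j => v (k.succAbove j)) := by
  induction s with
  | zero =>
    rw [ExteriorAlgebra.ιMulti_succ_apply, contract_ι_mul]
    simp [contract_one]
  | succ s ih =>
    rw [ExteriorAlgebra.ιMulti_succ_apply, contract_ι_mul, Matrix.vecTail, ih,
      Fin.sum_univ_succ (n := s + 1), Finset.mul_sum, sub_eq_add_neg, ← Finset.sum_neg_distrib]
    congr 1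
    · simp
      rfl
    · refine Finset.sum_congr rfl fun k _ => ?_
      rw [ExteriorAlgebra.ιMulti_succ_apply (n := s), mul_smul_comm, ← neg_smul]
      congr 1
      · simp [pow_succ]
      · rw [Fin.succ_succAbove_zero]
        congr 2
        ext j : 1
        exact congrArg v (Fin.succ_succAbove_succ k j).symm

theorem contract_mem {f : Module.Dual ℤ M0} {s : ℕ} {x : Ext} (hx : x ∈ ⋀[ℤ]^(s + 1) M0) :
    contract f x ∈ ⋀[ℤ]^s M0 := by
  rw [← exteriorPower.ιMulti_span_fixedDegree] at hx
  induction hx using Submodule.span_induction with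
  | mem x hx =>
    obtain ⟨v, rfl⟩ := hx
    rw [contract_ιMulti]
    exact Submodule.sum_mem _ fun k _ => Submodule.smul_mem _ _
      (exteriorPower.ιMulti ℤ s fun j => v (k.succAbove j)).2
  | zero => rw [map_zero]; exact Submodule.zero_mem _
  | add x y _ _ hx hy => rw [map_add]; exact Submodule.add_mem _ hx hy
  | smul c x _ hx => rw [map_smul]; exact Submodule.smul_mem _ _ hx

theorem ι_mul_mem {v : M0} {s : ℕ} {x : Ext} (hx : x ∈ ⋀[ℤ]^s M0) :
    ExteriorAlgebra.ι ℤ v * x ∈ ⋀[ℤ]^(s + 1) M0 := by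
  rw [ExteriorAlgebra.exteriorPower, pow_succ']
  exact Submodule.mul_mem_mul ⟨v, rfl⟩ hx

/-! ### Coordinates -/

/-- The alternating map `v ↦ det (coeff_{c_l} v_k)`. -/
def coordAlt (s : ℕ) (c : Fin s → ℕ) : M0 [⋀^Fin s]→ₗ[ℤ] ℤ :=
  (Matrix.detRowAlternating (n := Fin s) (R := ℤ)).compLinearMap
    (LinearMap.pi fun l => beta (c l))

/-- The coordinate of the component of degree `s` along `b_{c_1} ∧ ⋯ ∧ b_{c_s}`. -/
def chi (s : ℕ) (c : Fin s → ℕ) : Ext →ₗ[ℤ] ℤ :=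
  ExteriorAlgebra.liftAlternating
    (Pi.single (M := fun i => M0 [⋀^Fin i]→ₗ[ℤ] ℤ) s (coordAlt s c))

theorem chi_ιMulti {s : ℕ} (c : Fin s → ℕ) (v : Fin s → M0) :
    chi s c (ExteriorAlgebra.ιMulti ℤ s v) = Matrix.det (Matrix.of fun k l => (v k).coeff (c l)) := by
  rw [chi, ExteriorAlgebra.liftAlternating_apply_ιMulti, Pi.single_eq_same]
  rfl

/-- Two linear maps on `⋀ M₀` agree on `⋀ˢ M₀` if they agree on products of basis vectors. -/
theorem eqOn_exteriorPower {N : Type*} [AddCommGroup N] {s : ℕ} {F G : Ext →ₗ[ℤ] N}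
    (hFG : ∀ c : Fin s → ℕ, F (ExteriorAlgebra.ιMulti ℤ s fun k => b (c k)) =
      G (ExteriorAlgebra.ιMulti ℤ s fun k => b (c k))) {x : Ext} (hx : x ∈ ⋀[ℤ]^s M0) :
    F x = G x := by
  have h1 : F.compAlternatingMap (ExteriorAlgebra.ιMulti ℤ s) =
      G.compAlternatingMap (ExteriorAlgebra.ιMulti ℤ s) := by
    refine Module.Basis.ext_alternating monoBasis fun c _ => ?_
    change F (ExteriorAlgebra.ιMulti ℤ s fun k => monoBasis (c k)) =
      G (ExteriorAlgebra.ιMulti ℤ s fun k => monoBasis (c k))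
    simp_rw [monoBasis_apply]
    exact hFG c
  rw [← exteriorPower.ιMulti_span_fixedDegree] at hx
  refine LinearMap.eqOn_span (f := F) (g := G) ?_ hx
  rintro _ ⟨v, rfl⟩
  exact congrArg (fun A => A v) h1

theorem chi_eq_ιMultiDual {s : ℕ} (t : Set.powersetCard ℕ s) (u : ⋀[ℤ]^s M0) :
    exteriorPower.ιMultiDual ℤ s monoBasis t u =
      chi s (Set.powersetCard.ofFinEmbEquiv.symm t) (u : Ext) := by
  have : exteriorPower.ιMultiDual ℤ s monoBasis t =
      (chi s (Set.powersetCard.ofFinEmbEquiv.symm t)).comp (Submodule.subtype _) := by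
    apply exteriorPower.linearMap_ext
    ext v
    simp only [LinearMap.compAlternatingMap_apply, exteriorPower.ιMultiDual_apply_ιMulti,
      LinearMap.comp_apply, Submodule.subtype_apply, exteriorPower.ιMulti_apply_coe, chi_ιMulti]
    rfl
  rw [this]
  rfl

/-- For increasing c these functionals are the coordinates in the basis of the exterior power
induced by `monoBasis`. -/
theorem eq_zero_of_chi {s : ℕ} {x : Ext} (hx : x ∈ ⋀[ℤ]^s M0)
    (h : ∀ c, chi s c x = 0) : x = 0 := by
  have : (⟨x, hx⟩ : ⋀[ℤ]^s M0) = 0 := by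
    apply (monoBasis.exteriorPower s).ext_elem
    intro t
    rw [exteriorPower.basis_repr_apply, chi_eq_ιMultiDual, h, map_zero]
    rfl
  exact congrArg Subtype.val this

/-- A relation satisfied by all coordinates is satisfied by all linear forms. -/
theorem sum_smul_eq_zero_of_chi {N I : Type*} [AddCommGroup N] {s : ℕ} (S : Finset I)
    (u : I → Ext) (hu : ∀ i, u i ∈ ⋀[ℤ]^s M0) (y : I → N)
    (h : ∀ c, ∑ i ∈ S, chi s c (u i) • y i = 0) (F : Ext →ₗ[ℤ] ℤ) :
    ∑ i ∈ S, F (u i) • y i = 0 := by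
  classical
  set e := monoBasis.exteriorPower s with he
  -- One finite set of basis indices serving all u i at once, so that the two sums can be exchanged.
  let T : Finset (Set.powersetCard ℕ s) := S.biUnion fun i => (e.repr ⟨u i, hu i⟩).support
  have key : ∀ i ∈ S, F (u i) =
      ∑ t ∈ T, chi s (Set.powersetCard.ofFinEmbEquiv.symm t) (u i) * F (e t : Ext) := by
    intro i hi
    have h1 := e.linearCombination_repr ⟨u i, hu i⟩
    rw [Finsupp.linearCombination_apply, Finsupp.sum_of_support_subset _
      (Finset.subset_biUnion_of_mem (fun i => (e.repr ⟨u i, hu i⟩).support) hi) _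
      (by simp)] at h1
    have h2 := congrArg (fun x : ⋀[ℤ]^s M0 => F (x : Ext)) h1
    simp only [Submodule.coe_sum, Submodule.coe_smul, map_sum, map_smul] at h2
    rw [← h2]
    refine Finset.sum_congr rfl fun t _ => ?_
    rw [he, exteriorPower.basis_repr_apply, chi_eq_ιMultiDual, smul_eq_mul]
  rw [Finset.sum_congr rfl fun i hi => by rw [key i hi, Finset.sum_smul], Finset.sum_comm]
  refine Finset.sum_eq_zero fun t _ => ?_
  simp_rw [mul_comm _ (F (e t : Ext)), mul_smul, ← Finset.smul_sum]
  rw [h, smul_zero]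

/-- Expansion of the coordinate determinant along its first column. It makes induction on the degree
possible. -/
theorem chi_contract {s : ℕ} (c : Fin (s + 1) → ℕ) {x : Ext} (hx : x ∈ ⋀[ℤ]^(s + 1) M0) :
    chi s (fun j => c j.succ) (contract (beta (c 0)) x) = chi (s + 1) c x := by
  refine eqOn_exteriorPower (F := (chi s (fun j => c j.succ)).comp (contract (beta (c 0))))
    (fun v => ?_) hx
  rw [LinearMap.comp_apply, contract_ιMulti, chi_ιMulti, Matrix.det_succ_column_zero, map_sum]
  refine Finset.sum_congr rfl fun k _ => ?_
  rw [map_smul, chi_ιMulti, smul_eq_mul]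
  rfl

/-! ### Decomposability over `ℤ` and the Plücker relations -/

/-- A nonzero vector of `M₀` is a multiple of a unimodular one. -/
theorem exists_unimodular {w : M0} (hw : w ≠ 0) :
    ∃ (g : ℤ) (v : M0) (f : Module.Dual ℤ M0), g ≠ 0 ∧ w = g • v ∧ f v = 1 := by
  -- The ideal of all values of linear forms at w. Its generator g is the content of w, and g ∈ I
  -- supplies the form f.
  let I : Submodule ℤ ℤ := LinearMap.range (LinearMap.applyₗ (R := ℤ) (M₂ := ℤ) w)
  set g := Submodule.IsPrincipal.generator I with hg
  have hdvd : ∀ i, g ∣ w.coeff i := fun i =>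
    (Submodule.IsPrincipal.mem_iff_generator_dvd I).1 ⟨beta i, rfl⟩
  obtain ⟨v, hv⟩ := (Polynomial.C_dvd_iff_dvd_coeff g w).2 hdvd
  have hwv : w = g • v := by rw [hv, Polynomial.smul_eq_C_mul]
  have hg0 : g ≠ 0 := by
    intro h0
    rw [h0, zero_smul] at hwv
    exact hw hwv
  obtain ⟨f, hf⟩ := Submodule.IsPrincipal.generator_mem I
  refine ⟨g, v, f, hg0, hwv, ?_⟩
  have h1 : f w = g := hf
  rw [hwv, map_smul, smul_eq_mul] at h1
  exact mul_left_cancel₀ hg0 (h1.trans (mul_one g).symm)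

/-- The contractions of `x` only involve the forms `β_0, …, β_{n-1}`. -/
def SupportedBelow (n : ℕ) (x : Ext) : Prop :=
  ∀ f : Module.Dual ℤ M0, contract f x = ∑ i ∈ Finset.range n, f (b i) • contract (beta i) x

/-- The Plücker relations `∑ (β_i ⌟ x) ⊗ (b_i ∧ x) = 0`, tested by linear forms on the left. -/
def PluckerRelations (n : ℕ) (x : Ext) : Prop :=
  ∀ F : Ext →ₗ[ℤ] ℤ, ∑ i ∈ Finset.range n,
    F (contract (beta i) x) • (ExteriorAlgebra.ι ℤ (b i) * x) = 0

theorem SupportedBelow.contract {n : ℕ} {x : Ext} (hx : SupportedBelow n x)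
    (g : Module.Dual ℤ M0) : SupportedBelow n (contract g x) := by
  intro f
  rw [contract_comm, hx f, map_sum, ← Finset.sum_neg_distrib]
  refine Finset.sum_congr rfl fun i _ => ?_
  rw [map_smul, contract_comm g, smul_neg, neg_neg]

/-- The working form of the relations: each F produces an explicit vector whose wedge with x is
zero. -/
theorem PluckerRelations.ι_sum_mul {n : ℕ} {x : Ext} (h : PluckerRelations n x)
    (F : Ext →ₗ[ℤ] ℤ) : ExteriorAlgebra.ι ℤ
      (∑ i ∈ Finset.range n, F (SchubertDerivation.contract (beta i) x) • b i) * x = 0 := by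
  rw [← h F, map_sum, Finset.sum_mul]
  simp only [map_smul, smul_mul_assoc]

/-- Apply the relations for x to -F(f ⌟ ·). Since contractions anticommute, the resulting vector w
with w ∧ x = 0 is also the one attached to F and f ⌟ x. As f(w) = F(f ⌟ (f ⌟ x)) = 0, contracting w
∧ x = 0 by f leaves w ∧ (f ⌟ x) = 0. -/
theorem PluckerRelations.contract {n : ℕ} {x : Ext} (hs : SupportedBelow n x)
    (h : PluckerRelations n x) (f : Module.Dual ℤ M0) :
    PluckerRelations n (contract f x) := by
  intro F
  have h1 := h.ι_sum_mul (-(F.comp (SchubertDerivation.contract f)))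
  set w := ∑ i ∈ Finset.range n,
    (-(F.comp (SchubertDerivation.contract f))) (SchubertDerivation.contract (beta i) x) • b i
    with hw
  have hcoef : ∀ i, (-(F.comp (SchubertDerivation.contract f)))
      (SchubertDerivation.contract (beta i) x) =
      F (SchubertDerivation.contract (beta i) (SchubertDerivation.contract f x)) := by
    intro i
    rw [LinearMap.neg_apply, LinearMap.comp_apply, contract_comm f, map_neg, neg_neg]
  have hfw : f w = 0 := by
    have h2 := congrArg F (hs.contract f f)
    rw [contract_contract, map_zero, map_sum] at h2
    rw [hw, map_sum, h2]
    refine Finset.sum_congr rfl fun i _ => ?_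
    rw [hcoef, map_smul, map_smul, smul_eq_mul, smul_eq_mul, mul_comm]
  have h3 := congrArg (SchubertDerivation.contract f) h1
  rw [contract_ι_mul, hfw, zero_smul, zero_sub, map_zero, neg_eq_zero, hw, map_sum,
    Finset.sum_mul] at h3
  rw [← h3]
  refine Finset.sum_congr rfl fun i _ => ?_
  rw [hcoef, map_smul, smul_mul_assoc]

theorem smul_eq_zero_of_mem {s : ℕ} {x : Ext} (hx : x ∈ ⋀[ℤ]^s M0) {g : ℤ} (hg : g ≠ 0)
    (h : g • x = 0) : x = 0 := by
  refine eq_zero_of_chi hx fun c => ?_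
  have := congrArg (chi s c) h
  rw [map_smul, map_zero, smul_eq_mul] at this
  exact (mul_eq_zero.1 this).resolve_left hg

theorem exists_ιMulti_of_plucker (n r : ℕ) : ∀ x ∈ ⋀[ℤ]^(r + 1) M0, SupportedBelow n x →
    PluckerRelations n x → ∃ v : Fin (r + 1) → M0, ExteriorAlgebra.ιMulti ℤ (r + 1) v = x := by
  induction r with
  | zero =>
    intro x hx _ _
    rw [ExteriorAlgebra.exteriorPower, zero_add, pow_one] at hx
    obtain ⟨v, rfl⟩ := hx
    refine ⟨fun _ => v, ?_⟩
    rw [ExteriorAlgebra.ιMulti_succ_apply, ExteriorAlgebra.ιMulti_zero_apply, mul_one]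
  | succ r ih =>
    intro x hx hs hp
    by_cases hx0 : x = 0
    · refine ⟨fun _ => 0, ?_⟩
      rw [hx0]
      exact (ExteriorAlgebra.ιMulti ℤ (r + 1 + 1)).map_coord_zero (0 : Fin (r + 1 + 1)) rfl
    obtain ⟨c, hc⟩ : ∃ c, chi (r + 2) c x ≠ 0 := by
      by_contra! hcon
      exact hx0 (eq_zero_of_chi hx hcon)
    -- A nonzero coordinate of x becomes F(β_{c 0} ⌟ x) ≠ 0. This number is the coefficient of w at
    -- `c 0`, so w ≠ 0.
    rw [← chi_contract c hx] at hc
    set F := chi (r + 1) fun j => c j.succ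
    set w := ∑ i ∈ Finset.range n, F (contract (beta i) x) • b i with hw
    have hw0 : w ≠ 0 := by
      intro h0
      have h1 := congrArg (beta (c 0)) h0
      rw [hw, map_sum, map_zero] at h1
      apply hc
      rw [hs (beta (c 0)), map_sum, ← h1]
      refine Finset.sum_congr rfl fun i _ => ?_
      rw [map_smul, map_smul, smul_eq_mul, smul_eq_mul, mul_comm]
    obtain ⟨g, v, f, hg, hwv, hfv⟩ := exists_unimodular hw0
    -- The content g can be cancelled because the exterior power is torsion-free.
    have hvx : ExteriorAlgebra.ι ℤ v * x = 0 := by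
      refine smul_eq_zero_of_mem (ι_mul_mem hx) hg ?_
      rw [← smul_mul_assoc, ← map_smul, ← hwv]
      exact hp.ι_sum_mul F
    have hxv : x = ExteriorAlgebra.ι ℤ v * contract f x := by
      have := contract_ι_mul f v x
      rwa [hvx, map_zero, hfv, one_smul, eq_comm, sub_eq_zero] at this
    obtain ⟨u, hu⟩ := ih (contract f x) (contract_mem hx) (hs.contract f) (hp.contract hs f)
    refine ⟨Fin.cons v u, ?_⟩
    rw [ExteriorAlgebra.ιMulti_succ_apply, Matrix.vecTail]
    conv_rhs => rw [hxv, ← hu]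
    rfl

theorem supportedBelow_ιMulti_b {n s : ℕ} {c : Fin s → ℕ} (hc : ∀ k, c k < n) :
    SupportedBelow n (ExteriorAlgebra.ιMulti ℤ s fun k => b (c k)) := by
  cases s with
  | zero => intro f; simp [contract_one]
  | succ s =>
    intro f
    simp_rw [contract_ιMulti, Finset.smul_sum]
    rw [Finset.sum_comm]
    refine Finset.sum_congr rfl fun k _ => ?_
    rw [Finset.sum_eq_single_of_mem (c k) (Finset.mem_range.2 (hc k))]
    · rw [Polynomial.lcoeff_apply, coeff_b, if_pos rfl, smul_smul]
      congr 1
      ring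
    · intro i _ hi
      rw [Polynomial.lcoeff_apply, coeff_b, if_neg hi, mul_zero, zero_smul, smul_zero]

theorem SupportedBelow.add {n : ℕ} {x y : Ext} (hx : SupportedBelow n x)
    (hy : SupportedBelow n y) : SupportedBelow n (x + y) := by
  intro f
  simp only [map_add, smul_add, Finset.sum_add_distrib]
  rw [hx f, hy f]

theorem SupportedBelow.smul {n : ℕ} {x : Ext} (a : ℤ) (hx : SupportedBelow n x) :
    SupportedBelow n (a • x) := by
  intro f
  simp only [map_smul]
  rw [hx f, Finset.smul_sum]
  exact Finset.sum_congr rfl fun i _ => smul_comm _ _ _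

theorem SupportedBelow.sum {n : ℕ} {I : Type*} {S : Finset I} {x : I → Ext}
    (hx : ∀ i ∈ S, SupportedBelow n (x i)) : SupportedBelow n (∑ i ∈ S, x i) :=
  Finset.sum_induction x (SupportedBelow n) (fun _ _ => SupportedBelow.add)
    (fun f => by simp) hx

/-- The Plücker tensor `∑ (β_i ⌟ x) ⊗ (b_i ∧ x)` of a decomposable `x` vanishes, here after
applying linear maps to both factors. -/
theorem plucker_ιMulti {P Q : Type*} [AddCommGroup P] [AddCommGroup Q] {s n : ℕ}
    (v : Fin (s + 1) → M0) (hn : ∀ k i, n ≤ i → (v k).coeff i = 0) (F : Ext →ₗ[ℤ] P)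
    (G : Ext →ₗ[ℤ] Q) :
    ∑ i ∈ Finset.range n, F (contract (beta i) (ExteriorAlgebra.ιMulti ℤ (s + 1) v)) ⊗ₜ[ℤ]
      G (ExteriorAlgebra.ι ℤ (b i) * ExteriorAlgebra.ιMulti ℤ (s + 1) v) = 0 := by
  have hv : ∀ k, v k = ∑ i ∈ Finset.range n, (v k).coeff i • b i := by
    intro k
    conv_lhs => rw [(v k).as_sum_range' (max n ((v k).natDegree + 1)) (by omega)]
    rw [← Finset.sum_subset (s₁ := Finset.range n) (Finset.range_mono (le_max_left _ _))]
    · refine Finset.sum_congr rfl fun i _ => ?_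
      rw [b_eq_monomial, Polynomial.smul_monomial, smul_eq_mul, mul_one]
    · intro i _ hi
      rw [hn k i (by simpa using hi), Polynomial.monomial_zero_right]
  have hvv : ∀ k, ExteriorAlgebra.ι ℤ (v k) * ExteriorAlgebra.ιMulti ℤ (s + 1) v = 0 := by
    intro k
    rw [ExteriorAlgebra.ιMulti_apply]
    exact ExteriorAlgebra.ι_mul_prod_list v k
  simp_rw [contract_ιMulti, map_sum, TensorProduct.sum_tmul, map_smul]
  -- With k outermost, the right factors add up to (∑_i β_i(v_k) b_i) ∧ x = v_k ∧ x, which is zero.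
  rw [Finset.sum_comm]
  refine Finset.sum_eq_zero fun k _ => ?_
  simp_rw [TensorProduct.smul_tmul, ← TensorProduct.tmul_sum, mul_smul, ← Finset.smul_sum,
    Polynomial.lcoeff_apply, ← map_smul, ← smul_mul_assoc, ← map_smul, ← map_sum]
  rw [← Finset.sum_mul, ← map_sum, ← hv, hvv, map_zero, smul_zero, TensorProduct.tmul_zero]

/-! ### Bilateral sequences of coefficients -/

/-- The coefficients of a power series, as a bilateral sequence. -/
def bilateral {R : Type*} [CommRing R] (S : PowerSeries R) (j : ℤ) : R :=
  if j < 0 then 0 else PowerSeries.coeff j.toNat S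

theorem bilateral_natCast {R : Type*} [CommRing R] (S : PowerSeries R) (j : ℕ) :
    bilateral S (j : ℤ) = PowerSeries.coeff j S := by
  simp [bilateral]

theorem bilateral_of_neg {R : Type*} [CommRing R] (S : PowerSeries R) {j : ℤ} (hj : j < 0) :
    bilateral S j = 0 := if_pos hj

/-- The hypothesis on l ≥ N covers both uses: P of bounded degree, or c < N so that the shifted
index is negative. -/
theorem bilateral_mul {R : Type*} [CommRing R] (P S : PowerSeries R) {N : ℕ}
    {c : ℤ} (hN : ∀ l : ℕ, N ≤ l → PowerSeries.coeff l P * bilateral S (c - l) = 0) :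
    bilateral (P * S) c = ∑ l ∈ Finset.range N, PowerSeries.coeff l P * bilateral S (c - l) := by
  rcases lt_or_ge c 0 with hc | hc
  · rw [bilateral_of_neg _ hc, Finset.sum_eq_zero]
    intro l _
    rw [bilateral_of_neg _ (by omega), mul_zero]
  obtain ⟨c, rfl⟩ := Int.eq_ofNat_of_zero_le hc
  have h1 : ∑ l ∈ Finset.range (max N (c + 1)),
      PowerSeries.coeff l P * bilateral S ((c : ℤ) - l) =
      ∑ l ∈ Finset.range N, PowerSeries.coeff l P * bilateral S ((c : ℤ) - l) := by
    refine (Finset.sum_subset (Finset.range_mono (le_max_left _ _)) fun l _ hl => ?_).symm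
    exact hN l (by simpa using hl)
  have h2 : ∑ l ∈ Finset.range (max N (c + 1)),
      PowerSeries.coeff l P * bilateral S ((c : ℤ) - l) =
      ∑ l ∈ Finset.range (c + 1), PowerSeries.coeff l P * bilateral S ((c : ℤ) - l) := by
    refine (Finset.sum_subset (Finset.range_mono (le_max_right _ _)) fun l _ hl => ?_).symm
    rw [Finset.mem_range, not_lt] at hl
    rw [bilateral_of_neg _ (by omega), mul_zero]
  rw [← h1, h2, bilateral_natCast, PowerSeries.coeff_mul,
    Finset.Nat.sum_antidiagonal_eq_sum_range_succ
      (fun i j => PowerSeries.coeff i P * PowerSeries.coeff j S)]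
  refine Finset.sum_congr rfl fun l hl => ?_
  rw [Finset.mem_range] at hl
  rw [show (c : ℤ) - l = ((c - l : ℕ) : ℤ) by omega, bilateral_natCast]

theorem map_bilateral {R S : Type*} [CommRing R] [CommRing S] (f : R →+* S) (P : PowerSeries R)
    (j : ℤ) : f (bilateral P j) = bilateral (PowerSeries.map f P) j := by
  unfold bilateral
  split_ifs
  · exact map_zero f
  · rw [PowerSeries.coeff_map]

theorem h_eq_bilateral (s : ℕ) (j : ℤ) : h s j = bilateral (invE s) j := rfl

theorem h_of_neg {s : ℕ} {j : ℤ} (hj : j < 0) : h s j = 0 := if_pos hj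

theorem h_zero (s : ℕ) : h s 0 = 1 := by
  have := congrArg (PowerSeries.coeff 0) (E_mul_invE s)
  rw [PowerSeries.coeff_mul] at this
  simpa [h, E, PowerSeries.coeff_monomial] using this

theorem hRow_b (s c : ℕ) : hRow s (b c) = fun l : Fin s => h s ((c : ℤ) - (l : ℤ)) := by
  rw [← monoBasis_apply, hRow, Module.Basis.constr_basis]

theorem phiInv_ιMulti {s : ℕ} (v : Fin s → M0) :
    phiInv s (ExteriorAlgebra.ιMulti ℤ s v) = Matrix.det (Matrix.of fun k => hRow s (v k)) := by
  rw [phiInv, ExteriorAlgebra.liftAlternating_apply_ιMulti, Pi.single_eq_same]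
  rfl

theorem phiInv_ιMulti_b {s : ℕ} (c : Fin s → ℕ) :
    phiInv s (ExteriorAlgebra.ιMulti ℤ s fun k => b (c k)) =
      Matrix.det (Matrix.of fun k l : Fin s => h s ((c k : ℤ) - (l : ℤ))) := by
  simp_rw [phiInv_ιMulti, hRow_b]

/-! ### Symmetric functions and coordinates -/

/-- The evaluation of `e_i` at the elementary symmetric polynomial. -/
def symmEval (s : ℕ) : B s →ₐ[ℤ] MvPolynomial (Fin s) ℤ :=
  MvPolynomial.aeval fun i : Fin s => MvPolynomial.esymm (Fin s) ℤ (i + 1)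

theorem map_symmEval_E (s : ℕ) : PowerSeries.map (symmEval s : B s →+* MvPolynomial (Fin s) ℤ) (E s) =
    ∏ i : Fin s, (1 - PowerSeries.C (MvPolynomial.X (R := ℤ) i) * PowerSeries.X) := by
  simp_rw [sub_eq_add_neg]
  rw [Finset.prod_one_add, Finset.sum_powerset, Finset.card_fin, Finset.sum_range_succ']
  rw [E, map_add, map_one, map_sum, add_comm, ← Fin.sum_univ_eq_sum_range (fun k =>
    ∑ t ∈ Finset.powersetCard (k + 1) Finset.univ, ∏ i ∈ t,
      -(PowerSeries.C (MvPolynomial.X i) * PowerSeries.X)) s]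
  congr 1
  · refine Finset.sum_congr rfl fun k _ => ?_
    have h1 : ∀ t ∈ Finset.powersetCard ((k : ℕ) + 1) (Finset.univ : Finset (Fin s)),
        ∏ i ∈ t, -(PowerSeries.C (MvPolynomial.X (R := ℤ) i) * PowerSeries.X) =
        PowerSeries.monomial ((k : ℕ) + 1) ((-1) ^ ((k : ℕ) + 1) * ∏ i ∈ t, MvPolynomial.X i) := by
      intro t ht
      rw [Finset.prod_neg, Finset.prod_mul_distrib, Finset.prod_const,
        (Finset.mem_powersetCard.1 ht).2, ← map_prod, ← mul_assoc, PowerSeries.X_pow_eq,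
        ← map_one (PowerSeries.C (R := MvPolynomial (Fin s) ℤ)), ← map_neg, ← map_pow, ← map_mul]
      ext1 m
      rw [PowerSeries.coeff_C_mul, PowerSeries.coeff_monomial, PowerSeries.coeff_monomial,
        mul_ite, mul_one, mul_zero]
    rw [Finset.sum_congr rfl h1, ← map_sum, ← Finset.mul_sum]
    ext1 m
    rw [PowerSeries.coeff_map, PowerSeries.coeff_monomial, PowerSeries.coeff_monomial]
    split_ifs <;> simp [symmEval, MvPolynomial.esymm]
  · simp

/-- The coefficients of `∏_{k ≠ i} (1 - x_k w)`. -/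
def omitCoeff (s : ℕ) : Matrix (Fin s) (Fin s) (MvPolynomial (Fin s) ℤ) :=
  Matrix.of fun l i => PowerSeries.coeff (l : ℕ)
    (∏ k ∈ Finset.univ.erase i, (1 - PowerSeries.C (MvPolynomial.X k) * PowerSeries.X))

theorem coeff_prod_one_sub {R I : Type*} [CommRing R] (T : Finset I) (x : I → R) (l : ℕ)
    (hl : T.card < l) :
    PowerSeries.coeff l (∏ k ∈ T, (1 - PowerSeries.C (x k) * PowerSeries.X)) = 0 := by
  have h1 : (∏ k ∈ T, (1 - PowerSeries.C (x k) * PowerSeries.X)) =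
      ((∏ k ∈ T, (1 - Polynomial.C (x k) * Polynomial.X) : Polynomial R) : PowerSeries R) := by
    rw [← Polynomial.coeToPowerSeries.ringHom_apply, map_prod]
    simp
  rw [h1, Polynomial.coeff_coe]
  apply Polynomial.coeff_eq_zero_of_natDegree_lt
  refine lt_of_le_of_lt ((Polynomial.natDegree_prod_le _ _).trans
    (Finset.sum_le_card_nsmul _ _ 1 fun k _ => ?_)) (by simpa using hl)
  compute_degree

/-- After evaluation 1/E_s becomes ∏_k (1 - x_k w)⁻¹. Multiplying by ∏_{k ≠ i} (1 - x_k w) leaves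
1/(1 - x_i w), whose coefficients are the powers of x_i. -/
theorem sum_hRow_mul_omitCoeff {s : ℕ} (v : M0) (i : Fin s) :
    ∑ l, symmEval s (hRow s v l) * omitCoeff s l i =
      Polynomial.aeval (MvPolynomial.X (R := ℤ) i) v := by
  let F : M0 →ₗ[ℤ] MvPolynomial (Fin s) ℤ := ∑ l, (LinearMap.mulRight ℤ (omitCoeff s l i)).comp
    ((symmEval s).toLinearMap.comp ((LinearMap.proj l).comp (hRow s)))
  suffices h : F = (Polynomial.aeval (MvPolynomial.X (R := ℤ) i)).toLinearMap by
    have := congrArg (fun G => G v) h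
    simpa [F] using this
  refine monoBasis.ext fun c => ?_
  rw [monoBasis_apply]
  set P : PowerSeries (MvPolynomial (Fin s) ℤ) :=
    ∏ k ∈ Finset.univ.erase i, (1 - PowerSeries.C (MvPolynomial.X k) * PowerSeries.X) with hP
  have hinv : P * PowerSeries.map (symmEval s : B s →+* MvPolynomial (Fin s) ℤ) (invE s) =
      PowerSeries.mk fun c => MvPolynomial.X (R := ℤ) i ^ c := by
    have h1 := congrArg (PowerSeries.map (symmEval s : B s →+* MvPolynomial (Fin s) ℤ)) (E_mul_invE s)
    rw [map_mul, map_one, map_symmEval_E, ← Finset.mul_prod_erase _ _ (Finset.mem_univ i),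
      ← hP] at h1
    have h2 : (PowerSeries.mk fun c => MvPolynomial.X (R := ℤ) i ^ c) *
        (1 - PowerSeries.C (MvPolynomial.X i) * PowerSeries.X) = 1 := by
      ext1 c
      cases c with
      | zero => simp [mul_sub]
      | succ c =>
        rw [mul_sub, mul_one, mul_comm (PowerSeries.C _), ← mul_assoc, map_sub,
          PowerSeries.coeff_mul_C, PowerSeries.coeff_succ_mul_X]
        simp [PowerSeries.coeff_one, pow_succ]
    calc _ = ((PowerSeries.mk fun c => MvPolynomial.X (R := ℤ) i ^ c) *
        (1 - PowerSeries.C (MvPolynomial.X i) * PowerSeries.X)) *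
        (P * PowerSeries.map (symmEval s : B s →+* MvPolynomial (Fin s) ℤ) (invE s)) := by rw [h2, one_mul]
      _ = _ := by rw [mul_assoc, ← mul_assoc (1 - _), h1, mul_one]
  have h3 := bilateral_mul P (PowerSeries.map (symmEval s : B s →+* MvPolynomial (Fin s) ℤ) (invE s)) (N := s)
    (c := (c : ℤ)) (fun l hl => by
      rw [hP, coeff_prod_one_sub, zero_mul]
      rw [Finset.card_erase_of_mem (Finset.mem_univ i), Finset.card_fin]
      have := i.pos
      omega)
  rw [hinv, bilateral_natCast, PowerSeries.coeff_mk, ← Fin.sum_univ_eq_sum_range (fun l =>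
    PowerSeries.coeff l P * bilateral (PowerSeries.map (symmEval s : B s →+* MvPolynomial (Fin s) ℤ) (invE s))
      ((c : ℤ) - l)) s] at h3
  rw [AlgHom.toLinearMap_apply, b, map_pow (Polynomial.aeval _), Polynomial.aeval_X, h3]
  simp only [F, LinearMap.sum_apply, LinearMap.comp_apply, AlgHom.toLinearMap_apply,
    LinearMap.proj_apply, LinearMap.mulRight_apply]
  refine Finset.sum_congr rfl fun l _ => ?_
  rw [mul_comm, ← b, hRow_b, ← map_bilateral]
  rfl

/-- The bialternant formula for Schur polynomials, with `(omitCoeff s).det` in the role of the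
Vandermonde determinant. -/
theorem symmEval_phiInv_mul {s : ℕ} (v : Fin s → M0) :
    symmEval s (phiInv s (ExteriorAlgebra.ιMulti ℤ s v)) * (omitCoeff s).det =
      Matrix.det (Matrix.of fun k i =>
        Polynomial.aeval (MvPolynomial.X (R := ℤ) i) (v k)) := by
  rw [phiInv_ιMulti, AlgHom.map_det, ← Matrix.det_mul]
  congr 1
  ext1 k i
  rw [Matrix.mul_apply, Matrix.of_apply, ← sum_hRow_mul_omitCoeff]
  rfl

theorem symmEval_phiInv_mul_b {s : ℕ} (e : Fin s → ℕ) :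
    symmEval s (phiInv s (ExteriorAlgebra.ιMulti ℤ s fun k => b (e k))) * (omitCoeff s).det =
      ∑ σ : Equiv.Perm (Fin s), Equiv.Perm.sign σ •
        MvPolynomial.monomial (Finsupp.equivFunOnFinite.symm fun i => e (σ i)) (1 : ℤ) := by
  rw [symmEval_phiInv_mul, Matrix.det_apply]
  refine Finset.sum_congr rfl fun σ _ => ?_
  congr 1
  rw [MvPolynomial.monomial_eq, map_one, one_mul,
    Finsupp.prod_fintype _ _ (fun i => pow_zero _)]
  simp [b]

/-- The linear form on `B_s` giving the coordinate of `φ_s(p)` along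
`b_{c_1} ∧ ⋯ ∧ b_{c_s}`. -/
def coordB (s : ℕ) (c : Fin s → ℕ) : B s →ₗ[ℤ] ℤ :=
  (MvPolynomial.lcoeff ℤ (Finsupp.equivFunOnFinite.symm c)).comp
    ((LinearMap.mulRight ℤ (omitCoeff s).det).comp (symmEval s).toLinearMap)

theorem coordB_apply {s : ℕ} (c : Fin s → ℕ) (p : B s) : coordB s c p =
    MvPolynomial.coeff (Finsupp.equivFunOnFinite.symm c) (symmEval s p * (omitCoeff s).det) :=
  rfl

/-- In the alternant with exponents e, the monomial x^c collects the signs of the σ with e ∘ σ = c.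
That is the determinant of Kronecker deltas computing the coordinate. -/
theorem coordB_phiInv {s : ℕ} (c : Fin s → ℕ) {x : Ext} (hx : x ∈ ⋀[ℤ]^s M0) :
    coordB s c (phiInv s x) = chi s c x := by
  refine eqOn_exteriorPower (F := (coordB s c).comp (phiInv s)) (fun e => ?_) hx
  rw [LinearMap.comp_apply, coordB_apply, symmEval_phiInv_mul_b, chi_ιMulti, Matrix.det_apply,
    MvPolynomial.coeff_sum]
  refine Finset.sum_congr rfl fun σ _ => ?_
  rw [MvPolynomial.coeff_smul]
  congr 1
  rw [MvPolynomial.coeff_monomial]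
  simp only [Matrix.of_apply, coeff_b, Finset.prod_ite_zero, Finset.prod_const_one,
    EmbeddingLike.apply_eq_iff_eq, funext_iff, Finset.mem_univ, true_implies]
  exact if_congr (forall_congr' fun _ => eq_comm) rfl rfl

/-- Coordinates can be read off after φ⁻¹. Injectivity suffices to make `phi` a left inverse;
surjectivity plays no role, since `phi` is only evaluated on the image. -/
theorem phiInv_injective (s : ℕ) :
    Function.Injective fun m : ⋀[ℤ]^s M0 => phiInv s (m : Ext) := by
  intro x y hxy
  apply Subtype.ext
  rw [← sub_eq_zero]
  refine eq_zero_of_chi (Submodule.sub_mem _ x.2 y.2) fun c => ?_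
  rw [← coordB_phiInv c (Submodule.sub_mem _ x.2 y.2), map_sub, sub_eq_zero.2 hxy, map_zero]

theorem phi_phiInv {s : ℕ} (m : ⋀[ℤ]^s M0) : phi s (phiInv s (m : Ext)) = m :=
  Function.leftInverse_invFun (phiInv_injective s) m

/-- The partition `(j, 0, …, 0)`. -/
def rowPartition (s j : ℕ) : Fin (s + 1) → ℕ := fun i => if i = 0 then j else 0

theorem schurDet_rowPartition {R : Type*} [CommRing R] (s j : ℕ) {g : ℤ → R} (h0 : g 0 = 1)
    (hneg : ∀ i < 0, g i = 0) : schurDet (rowPartition s j) g = g j := by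
  rw [schurDet, Matrix.det_of_isLowerTriangular, Fin.prod_univ_succ, Finset.prod_eq_one]
  · simp [rowPartition]
  · intro i _
    simp [rowPartition, Fin.succ_ne_zero, h0]
  · intro i k (hik : i < k)
    have hk : k ≠ 0 := (lt_of_le_of_lt (Fin.zero_le i) hik).ne'
    rw [Matrix.of_apply, rowPartition, if_neg hk]
    apply hneg
    rw [Fin.lt_def] at hik
    push_cast
    omega

theorem phiInv_wedge_rowPartition (s j : ℕ) :
    phiInv (s + 1) (wedge (rowPartition s j) : Ext) = h (s + 1) j := by
  rw [phiInv_wedge, schurDet_rowPartition s j (h_zero _) fun _ => h_of_neg]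

/-- For j ≥ 0, h_j times `(omitCoeff s).det` becomes the alternant with exponents 0, …, s-2, s-1+j.
As s-1+j ≥ n, each of its monomials has an exponent at least n, and multiplication by q cannot lower
it. -/
theorem coordB_mul_h {s n : ℕ} {c : Fin s → ℕ} (hc : ∀ i, c i < n) (q : B s) {j : ℤ}
    (hj : j ∈ Set.Icc ((n : ℤ) - (s : ℤ) + 1) (n : ℤ)) : coordB s c (q * h s j) = 0 := by
  rcases lt_or_ge j 0 with hj0 | hj0
  · rw [h_of_neg hj0, mul_zero, map_zero]
  obtain ⟨j, rfl⟩ := Int.eq_ofNat_of_zero_le hj0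
  cases s with
  | zero =>
    obtain ⟨h1, h2⟩ := hj
    push_cast at h1 h2
    omega
  | succ s =>
    rw [← phiInv_wedge_rowPartition, coordB_apply, map_mul, mul_assoc, wedge,
      exteriorPower.ιMulti_apply_coe,
      symmEval_phiInv_mul_b (fun k : Fin (s + 1) => k + rowPartition s j k.rev), Finset.mul_sum,
      MvPolynomial.coeff_sum]
    refine Finset.sum_eq_zero fun σ _ => ?_
    rw [mul_smul_comm, MvPolynomial.coeff_smul, MvPolynomial.coeff_mul_monomial', if_neg, smul_zero]
    intro hle
    -- The variable that carries the top exponent s + j, here with s + 1 variables.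
    have h1 := hle (σ.symm (Fin.last s))
    have h2 := hc (σ.symm (Fin.last s))
    have h3 := hj.1
    simp [rowPartition] at h1 h3
    omega

/-- The coordinate `coordB` on the quotient `B_{s,n}`. -/
def coordBT (s n : ℕ) (c : Fin s → ℕ) (hc : ∀ i, c i < n) : BT s n →ₗ[ℤ] ℤ :=
  ((truncIdeal s n).restrictScalars ℤ).liftQ (coordB s c) <| by
    intro p hp
    rw [Submodule.restrictScalars_mem, truncIdeal] at hp
    rw [LinearMap.mem_ker]
    -- `coordB` is only ℤ-linear, so the induction over the ideal must carry all multiples of p.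
    suffices h : ∀ q, coordB s c (q * p) = 0 by simpa using h 1
    refine Submodule.span_induction (p := fun p _ => ∀ q, coordB s c (q * p) = 0) ?_ ?_ ?_ ?_ hp
    · rintro _ ⟨j, hj, rfl⟩ q
      exact coordB_mul_h hc q hj
    · intro q
      rw [mul_zero, map_zero]
    · intro x y _ _ hx hy q
      rw [mul_add, map_add, hx, hy, add_zero]
    · intro a x _ hx q
      rw [smul_eq_mul, ← mul_assoc]
      exact hx _

theorem coordBT_proj {s n : ℕ} {c : Fin s → ℕ} (hc : ∀ i, c i < n) (p : B s) :
    coordBT s n c hc (proj s n p) = coordB s c p := rfl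

/-! ### The transported Schubert derivations -/

theorem schurDet_eq_det {R : Type*} [CommRing R] {s : ℕ} (lam : Fin s → ℕ) (g : ℤ → R) :
    schurDet lam g =
      Matrix.det (Matrix.of fun k l : Fin s => g (((k + lam k.rev : ℕ) : ℤ) - (l : ℤ))) := by
  rw [schurDet, ← Matrix.det_transpose, ← Matrix.det_submatrix_equiv_self (Fin.revPerm (n := s))]
  congr 1
  ext1 k l
  simp only [Matrix.submatrix_apply, Matrix.transpose_apply, Matrix.of_apply, Fin.revPerm_apply]
  refine congrArg g ?_
  have hk := Fin.val_rev k
  have hl := Fin.val_rev l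
  have hk' := k.isLt
  have hl' := l.isLt
  omega

/-- `φ_s⁻¹` applied to the coefficients of a polynomial. -/
def polyPhiInv (s : ℕ) : Polynomial Ext →ₗ[ℤ] Polynomial (B s) where
  toFun P := P.sum fun i m => Polynomial.monomial i (phiInv s m)
  map_add' P Q := Polynomial.sum_add_index _ _ _ (by simp) (by simp)
  map_smul' a P := by
    rw [Polynomial.sum_smul_index' _ _ _ (by simp), Polynomial.sum_def, Polynomial.sum_def,
      RingHom.id_apply, Finset.smul_sum]
    simp only [map_smul, Polynomial.smul_monomial]

theorem polyPhiInv_monomial (s i : ℕ) (x : Ext) :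
    polyPhiInv s (Polynomial.monomial i x) = Polynomial.monomial i (phiInv s x) :=
  Polynomial.sum_monomial_index x (fun i m => Polynomial.monomial i (phiInv s m)) (by simp)

/-- The inclusion of `M₀[w]` in `(⋀ M₀)[w]`. -/
def polyι : (ℕ →₀ M0) →ₗ[ℤ] Polynomial Ext :=
  Finsupp.lsum ℤ fun i =>
    ((Polynomial.monomial i : Ext →ₗ[Ext] Polynomial Ext).restrictScalars ℤ).comp
      (ExteriorAlgebra.ι ℤ)

theorem polyι_single (i : ℕ) (v : M0) :
    polyι (Finsupp.single i v) = Polynomial.monomial i (ExteriorAlgebra.ι ℤ v) := by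
  simp [polyι]

/-- The extension of `hRow` to `M₀[w]`. -/
def polyHRow (s : ℕ) : (ℕ →₀ M0) →ₗ[ℤ] (Fin s → Polynomial (B s)) :=
  Finsupp.lsum ℤ fun i => LinearMap.pi fun l =>
    ((Polynomial.monomial i : B s →ₗ[B s] Polynomial (B s)).restrictScalars ℤ).comp
      ((LinearMap.proj l).comp (hRow s))

theorem polyHRow_single (s i : ℕ) (v : M0) (l : Fin s) :
    polyHRow s (Finsupp.single i v) l = Polynomial.monomial i (hRow s v l) := by
  simp [polyHRow]

theorem prod_ofFn_monomial {R : Type*} [Semiring R] {s : ℕ} (i : Fin s → ℕ) (u : Fin s → R) :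
    (List.ofFn fun k => Polynomial.monomial (i k) (u k)).prod =
      Polynomial.monomial (∑ k, i k) (List.ofFn u).prod := by
  induction s with
  | zero => simp
  | succ s ih =>
    rw [List.ofFn_succ, List.prod_cons, ih, Polynomial.monomial_mul_monomial, List.ofFn_succ,
      List.prod_cons, Fin.sum_univ_succ]

/-- Both sides are multilinear in q. On elements wⁱ b_j the powers of w come out of the rows, which
leaves the definition of φ⁻¹. -/
theorem polyPhiInv_prod {s : ℕ} (q : Fin s → ℕ →₀ M0) :
    polyPhiInv s (List.ofFn fun k => polyι (q k)).prod =
      Matrix.det (Matrix.of fun k => polyHRow s (q k)) := by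
  let F : MultilinearMap ℤ (fun _ : Fin s => ℕ →₀ M0) (Polynomial (B s)) :=
    (polyPhiInv s).compMultilinearMap
      ((MultilinearMap.mkPiAlgebraFin ℤ s (Polynomial Ext)).compLinearMap fun _ => polyι)
  let G : MultilinearMap ℤ (fun _ : Fin s => ℕ →₀ M0) (Polynomial (B s)) :=
    ((Matrix.detRowAlternating (n := Fin s)
      (R := Polynomial (B s))).toMultilinearMap.restrictScalars ℤ).compLinearMap
        fun _ => polyHRow s
  suffices h : F = G by
    have := congrArg (fun A => A q) h
    exact Eq.trans (by simp [F]) this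
  refine Module.Basis.ext_multilinear
    (fun _ => Finsupp.basis fun _ : ℕ => monoBasis) fun t => ?_
  have hb : ∀ k, (Finsupp.basis fun _ : ℕ => monoBasis) (t k) =
      Finsupp.single (t k).1 (b (t k).2) := by
    intro k
    rw [Finsupp.coe_basis]
    exact congrArg _ (monoBasis_apply _)
  simp_rw [hb]
  change polyPhiInv s (List.ofFn fun k => polyι (Finsupp.single (t k).1 (b (t k).2))).prod =
    Matrix.det (Matrix.of fun k => polyHRow s (Finsupp.single (t k).1 (b (t k).2)))
  simp_rw [polyι_single]
  rw [prod_ofFn_monomial, polyPhiInv_monomial, ← ExteriorAlgebra.ιMulti_apply, phiInv_ιMulti]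
  have hM : (Matrix.of fun k => polyHRow s (Finsupp.single (t k).1 (b (t k).2))) =
      Matrix.of fun k l => (Polynomial.X : Polynomial (B s)) ^ (t k).1 *
        (Polynomial.C.mapMatrix (Matrix.of fun k => hRow s (b (t k).2))) k l := by
    ext1 k l
    rw [Matrix.of_apply, polyHRow_single, Matrix.of_apply, RingHom.mapMatrix_apply,
      Matrix.map_apply, Matrix.of_apply, mul_comm, Polynomial.C_mul_X_pow_eq_monomial]
  rw [hM, Matrix.det_mul_column, ← RingHom.map_det, Finset.prod_pow_eq_pow_sum, mul_comm,
    Polynomial.C_mul_X_pow_eq_monomial]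

theorem hsDerivation_ιMulti_b (f : ℕ → Polynomial Ext) (hf : ∀ j, f j ∈ degOne) {s : ℕ}
    (c : Fin s → ℕ) : hsDerivation f hf (ExteriorAlgebra.ιMulti ℤ s fun k => b (c k)) =
      (List.ofFn fun k => f (c k)).prod := by
  rw [ExteriorAlgebra.ιMulti_apply, map_list_prod, List.map_ofFn]
  congr 2
  ext1 k
  rw [Function.comp_apply, hsDerivation, ExteriorAlgebra.lift_ι_apply, genMap, ← monoBasis_apply,
    Module.Basis.constr_basis]

/-- A Hasse–Schmidt derivation acts on each wedge factor separately, hence on each row of the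
determinant. It therefore suffices that one row transforms entrywise by a single sequence g. -/
theorem transport_schurDet {s : ℕ} (f : ℕ → Polynomial Ext) (hf : ∀ j, f j ∈ degOne)
    (q : ℕ → ℕ →₀ M0) (hq : ∀ j, f j = polyι (q j)) (g : ℤ → Polynomial (B s))
    (hg : ∀ (j : ℕ) (l : Fin s), polyHRow s (q j) l = g ((j : ℤ) - l)) (lam : Fin s → ℕ) :
    transport s (hsDerivation f hf) (schurDet lam (h s)) = schurDet lam g := by
  have h1 : transport s (hsDerivation f hf) (schurDet lam (h s)) =
      polyPhiInv s (hsDerivation f hf (wedge lam : Ext)) := by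
    rw [← phiInv_wedge, transport, phi_phiInv]
    rfl
  rw [h1, wedge, exteriorPower.ιMulti_apply_coe,
    hsDerivation_ιMulti_b f hf (fun k : Fin s => k + lam k.rev)]
  simp_rw [hq]
  rw [polyPhiInv_prod, schurDet_eq_det]
  congr 1
  ext1 k l
  exact hg _ _

theorem transport_zero (s : ℕ) (D : Ext →ₐ[ℤ] Polynomial Ext) : transport s D 0 = 0 := by
  have h0 : phi s 0 = 0 := by
    have := phi_phiInv (0 : ⋀[ℤ]^s M0)
    rwa [Submodule.coe_zero, map_zero] at this
  rw [transport, h0, Submodule.coe_zero, map_zero, Polynomial.sum_zero_index]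

/-- The sequence `∑_i h_{j-i} z⁻ⁱ`. -/
def sigmaSeq (s : ℕ) (j : ℤ) : Polynomial (B s) :=
  bilateral ((PowerSeries.mk fun i => (Polynomial.X : Polynomial (B s)) ^ i) *
    PowerSeries.map Polynomial.C (invE s)) j

/-- The sequence `h_j - h_{j-1} z⁻¹`. -/
def sigmaBarSeq (s : ℕ) (j : ℤ) : Polynomial (B s) :=
  Polynomial.C (h s j) - Polynomial.X * Polynomial.C (h s (j - 1))

theorem sigmaSeq_of_neg {s : ℕ} {j : ℤ} (hj : j < 0) : sigmaSeq s j = 0 :=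
  bilateral_of_neg _ hj

theorem sigmaBarSeq_of_neg {s : ℕ} {j : ℤ} (hj : j < 0) : sigmaBarSeq s j = 0 := by
  rw [sigmaBarSeq, h_of_neg hj, h_of_neg (by omega)]
  simp

theorem sigmaSeq_eq_sum {s : ℕ} {j : ℤ} {N : ℕ} (hN : j < N) :
    sigmaSeq s j = ∑ i ∈ Finset.range N, Polynomial.monomial i (h s (j - i)) := by
  rw [sigmaSeq, bilateral_mul (N := N)]
  · refine Finset.sum_congr rfl fun i _ => ?_
    rw [PowerSeries.coeff_mk, ← map_bilateral, mul_comm, Polynomial.C_mul_X_pow_eq_monomial]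
    rfl
  · intro l hl
    rw [bilateral_of_neg _ (by omega), mul_zero]

theorem sigmaSeq_zero (s : ℕ) : sigmaSeq s 0 = 1 := by
  rw [sigmaSeq_eq_sum (N := 1) (by norm_num)]
  simp [h_zero]

theorem sigmaBarSeq_zero (s : ℕ) : sigmaBarSeq s 0 = 1 := by
  rw [sigmaBarSeq, h_zero, h_of_neg (by norm_num)]
  simp

theorem sigmaMinusB_schurDet {s : ℕ} (lam : Fin s → ℕ) :
    sigmaMinusB s (schurDet lam (h s)) = schurDet lam (sigmaSeq s) := by
  refine transport_schurDet sigmaGen sigmaGen_mem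
    (fun j => ∑ i ∈ Finset.range (j + 1), Finsupp.single i (b (j - i))) (fun j => ?_)
    _ (fun j l => ?_) lam
  · simp_rw [map_sum, polyι_single]
    rfl
  · rw [map_sum, Finset.sum_apply, sigmaSeq_eq_sum (N := j + 1) (by push_cast; omega)]
    refine Finset.sum_congr rfl fun i hi => ?_
    rw [Finset.mem_range] at hi
    rw [polyHRow_single, hRow_b]
    congr 1
    exact congrArg (h s) (by omega)

theorem sigmaBarMinusB_schurDet {s : ℕ} (lam : Fin s → ℕ) :
    sigmaBarMinusB s (schurDet lam (h s)) = schurDet lam (sigmaBarSeq s) := by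
  refine transport_schurDet sigmaBarGen sigmaBarGen_mem
    (fun j => Finsupp.single 0 (b j) - if j = 0 then 0 else Finsupp.single 1 (b (j - 1)))
    (fun j => ?_) _ (fun j l => ?_) lam
  · rw [map_sub, polyι_single, sigmaBarGen]
    split_ifs
    · rw [map_zero]
    · rw [polyι_single]
  · rw [map_sub, Pi.sub_apply, polyHRow_single, hRow_b, sigmaBarSeq, Polynomial.monomial_zero_left]
    congr 1
    split_ifs with hj
    · rw [h_of_neg (by omega)]
      simp
    · rw [polyHRow_single, hRow_b, mul_comm, Polynomial.C_mul_X_eq_monomial]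
      congr 1
      exact congrArg (h s) (by omega)

/-- For s ≥ 1, h_j is a one-row Schur determinant, so σ₋ can be computed on it. For s = 0 no such
row exists, and the stated convention gives the same formula because E_0 = 1. -/
theorem sigmaMinusH_eq (s : ℕ) (j : ℤ) : sigmaMinusH s j = sigmaSeq s j := by
  cases s with
  | zero =>
    have hE : invE 0 = 1 := by
      have := E_mul_invE 0
      rwa [E, Finset.univ_eq_empty, Finset.sum_empty, add_zero, one_mul] at this
    rw [sigmaMinusH, if_pos rfl, sigmaSeq, hE, map_one, mul_one, bilateral]
    simp
  | succ s =>
    rw [sigmaMinusH, if_neg s.succ_ne_zero]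
    rcases lt_or_ge j 0 with hj | hj
    · rw [h_of_neg hj, sigmaSeq_of_neg hj, sigmaMinusB, transport_zero]
    · obtain ⟨j, rfl⟩ := Int.eq_ofNat_of_zero_le hj
      rw [← phiInv_wedge_rowPartition, phiInv_wedge, sigmaMinusB_schurDet,
        schurDet_rowPartition s j (sigmaSeq_zero _) fun _ => sigmaSeq_of_neg]

theorem sigmaBarMinusH_eq (s : ℕ) (j : ℤ) :
    sigmaBarMinusH (s + 1) j = sigmaBarSeq (s + 1) j := by
  rw [sigmaBarMinusH]
  rcases lt_or_ge j 0 with hj | hj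
  · rw [h_of_neg hj, sigmaBarSeq_of_neg hj, sigmaBarMinusB, transport_zero]
  · obtain ⟨j, rfl⟩ := Int.eq_ofNat_of_zero_le hj
    rw [← phiInv_wedge_rowPartition, phiInv_wedge, sigmaBarMinusB_schurDet,
      schurDet_rowPartition s j (sigmaBarSeq_zero _) fun _ => sigmaBarSeq_of_neg]

theorem map_schurDet {R S : Type*} [CommRing R] [CommRing S] (f : R →+* S) {s : ℕ}
    (lam : Fin s → ℕ) (g : ℤ → R) : f (schurDet lam g) = schurDet lam fun j => f (g j) := by
  rw [schurDet, RingHom.map_det]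
  rfl

/-! ### Two determinantal identities -/

section Determinants

variable {R : Type*} [CommRing R]

/-- With A = 1/(1 - yX), the entries on the right come from those of A·S by column operations: S =
(1 - yX)·(A·S) gives the first s columns and P·(A·S) = A gives the column of powers. The scalar on
the left is the determinant of the transition matrix. -/
theorem det_border_column {s : ℕ} (P S : PowerSeries R) (hPS : P * S = 1)
    (hP : ∀ l, s < l → PowerSeries.coeff l P = 0) (y : R) (c : Fin (s + 1) → ℕ) :
    (∑ l : Fin (s + 1), y ^ (s - (l : ℕ)) * PowerSeries.coeff (l : ℕ) P) *
      Matrix.det (Matrix.of fun k l : Fin (s + 1) =>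
        bilateral ((PowerSeries.mk fun i => y ^ i) * S) ((c k : ℤ) - (l : ℤ))) =
    Matrix.det (Matrix.of fun k : Fin (s + 1) =>
      (Fin.snoc (fun l : Fin s => bilateral S ((c k : ℤ) - (l : ℤ))) (y ^ c k) :
        Fin (s + 1) → R)) := by
  set A : PowerSeries R := PowerSeries.mk fun i => y ^ i with hA
  have hA1 : (1 - PowerSeries.C y * PowerSeries.X) * A = 1 := by
    ext1 i
    rw [sub_mul, one_mul, mul_assoc, map_sub, PowerSeries.coeff_C_mul]
    cases i with
    | zero => simp [hA]
    | succ i =>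
      rw [mul_comm PowerSeries.X, PowerSeries.coeff_succ_mul_X]
      simp [hA, PowerSeries.coeff_one, pow_succ']
  have hS : ∀ j : ℤ, bilateral S j = bilateral (A * S) j - y * bilateral (A * S) (j - 1) := by
    intro j
    conv_lhs => rw [← one_mul S, ← hA1, mul_assoc]
    rw [bilateral_mul (N := 2), Finset.sum_range_succ, Finset.sum_range_one]
    · simp [mul_comm _ (PowerSeries.X : PowerSeries R), PowerSeries.coeff_one, sub_eq_add_neg]
    · intro l hl
      obtain ⟨l, rfl⟩ := Nat.exists_eq_add_of_le' hl
      rw [map_sub, PowerSeries.coeff_one, if_neg (by omega), PowerSeries.coeff_C_mul,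
        PowerSeries.coeff_X, if_neg (by omega)]
      simp
  have hA2 : ∀ j : ℕ, y ^ j = ∑ l : Fin (s + 1),
      bilateral (A * S) ((j : ℤ) - (l : ℤ)) * PowerSeries.coeff (l : ℕ) P := by
    intro j
    have h1 : P * (A * S) = A := by rw [mul_left_comm, hPS, mul_one]
    have h2 : y ^ j = bilateral (P * (A * S)) j := by
      rw [h1, bilateral_natCast, hA, PowerSeries.coeff_mk]
    rw [h2, bilateral_mul (N := s + 1), ← Fin.sum_univ_eq_sum_range
      (fun l => PowerSeries.coeff l P * bilateral (A * S) ((j : ℤ) - (l : ℤ)))]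
    · exact Finset.sum_congr rfl fun l _ => mul_comm _ _
    · intro l hl
      rw [hP l hl, zero_mul]
  let U : Matrix (Fin (s + 1)) (Fin (s + 1)) R := Matrix.of fun l =>
    Fin.snoc (fun m : Fin s => (if l = m.castSucc then 1 else 0) - if l = m.succ then y else 0)
      (PowerSeries.coeff (l : ℕ) P)
  have hU1 : ∀ l (m : Fin s), U l m.castSucc =
      (if l = m.castSucc then 1 else 0) - if l = m.succ then y else 0 := by
    intro l m
    exact Fin.snoc_castSucc (α := fun _ => R) (PowerSeries.coeff (l : ℕ) P)
      (fun m : Fin s => (if l = m.castSucc then 1 else 0) - if l = m.succ then y else 0) m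
  have hU2 : ∀ l, U l (Fin.last s) = PowerSeries.coeff (l : ℕ) P := by
    intro l
    exact Fin.snoc_last (α := fun _ => R) (PowerSeries.coeff (l : ℕ) P)
      (fun m : Fin s => (if l = m.castSucc then 1 else 0) - if l = m.succ then y else 0)
  have hdet : U.det = ∑ l : Fin (s + 1), y ^ (s - (l : ℕ)) * PowerSeries.coeff (l : ℕ) P := by
    -- Replacing the last row by ∑ y^(s-l) row_l clears it except for its last entry; the remaining
    -- minor is unitriangular.
    have h1 := Matrix.det_updateRow_sum U (Fin.last s) fun l => y ^ (s - (l : ℕ))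
    rw [Fin.val_last, Nat.sub_self, pow_zero, one_smul] at h1
    rw [← h1, Matrix.det_succ_row _ (Fin.last s), Fin.sum_univ_castSucc,
      Finset.sum_eq_zero, zero_add, Matrix.updateRow_self, Matrix.det_of_isLowerTriangular,
      Finset.prod_eq_one, mul_one, Finset.sum_apply]
    · simp_rw [Pi.smul_apply, hU2, smul_eq_mul, Fin.val_last]
      rw [← two_mul, pow_mul]
      simp
    · intro i _
      rw [Matrix.submatrix_apply, Fin.succAbove_last,
        Matrix.updateRow_ne (Fin.castSucc_lt_last i).ne, hU1, if_pos rfl,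
        if_neg (Fin.castSucc_lt_succ (i := i)).ne, sub_zero]
    · intro i j (hij : i < j)
      rw [Matrix.submatrix_apply, Fin.succAbove_last,
        Matrix.updateRow_ne (Fin.castSucc_lt_last i).ne, hU1, if_neg, if_neg, sub_zero]
      · rw [Fin.ext_iff, Fin.val_castSucc, Fin.val_succ]
        omega
      · rw [Fin.ext_iff, Fin.val_castSucc, Fin.val_castSucc]
        omega
    · intro j _
      rw [Matrix.updateRow_self, Finset.sum_apply]
      simp_rw [Pi.smul_apply, hU1, smul_eq_mul, mul_sub, mul_ite, mul_one, mul_zero,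
        Finset.sum_sub_distrib]
      rw [Finset.sum_ite_eq' Finset.univ, Finset.sum_ite_eq' Finset.univ]
      simp only [Finset.mem_univ, if_true, Fin.val_castSucc, Fin.val_succ]
      rw [← pow_succ, show s - ((j : ℕ) + 1) + 1 = s - (j : ℕ) by omega, sub_self, mul_zero,
        zero_mul]
  rw [← hdet, mul_comm, ← Matrix.det_mul]
  congr 1
  ext1 k m
  rw [Matrix.mul_apply, Matrix.of_apply]
  refine Fin.lastCases ?_ (fun m => ?_) m
  · rw [Fin.snoc_last, hA2]
    simp_rw [hU2]
    rfl
  · rw [Fin.snoc_castSucc, hS]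
    simp_rw [hU1, mul_sub, mul_ite, mul_one, mul_zero, Finset.sum_sub_distrib]
    rw [Finset.sum_ite_eq' Finset.univ, Finset.sum_ite_eq' Finset.univ]
    simp only [Finset.mem_univ, if_true, Matrix.of_apply, Fin.val_castSucc, Fin.val_succ]
    rw [mul_comm y]
    congr 3
    push_cast
    ring

/-- Subtracting z times the preceding column clears the first row after its leading 1. Because yz =
1, a factor -z comes out of each of the r remaining columns. -/
theorem det_border_row {r : ℕ} (u : ℤ → R) {y z : R} (hyz : y * z = 1) (c : Fin r → ℕ) :
    Matrix.det (Matrix.of (Fin.cons (fun l => z ^ (l : ℕ))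
      (fun k l => u ((c k : ℤ) - (l : ℤ))) : Fin (r + 1) → Fin (r + 1) → R)) =
    (-z) ^ r * Matrix.det (Matrix.of fun k l : Fin r =>
      u ((c k : ℤ) - (l : ℤ)) - y * u ((c k : ℤ) - (l : ℤ) - 1)) := by
  let A : Matrix (Fin (r + 1)) (Fin (r + 1)) R :=
    Matrix.of (Fin.cons (fun l => z ^ (l : ℕ)) (fun k l => u ((c k : ℤ) - (l : ℤ))))
  let A' : Matrix (Fin (r + 1)) (Fin (r + 1)) R := Matrix.of fun k =>
    Fin.cons (A k 0) fun l => A k l.succ - z * A k l.castSucc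
  have h1 : A.det = A'.det := by
    refine Matrix.det_eq_of_forall_col_eq_smul_add_pred (fun _ => z) (fun i => rfl) fun i j => ?_
    change _ = A i j.succ - z * A i j.castSucc + _
    ring
  change A.det = _
  rw [h1, Matrix.det_succ_row_zero, Fin.sum_univ_succ, Finset.sum_eq_zero, add_zero]
  · have h2 : A'.submatrix Fin.succ (Fin.succAbove 0) = (-z) • (Matrix.of fun k l : Fin r =>
        u ((c k : ℤ) - (l : ℤ)) - y * u ((c k : ℤ) - (l : ℤ) - 1)) := by
      ext1 k l
      change u ((c k : ℤ) - ((l.succ : ℕ) : ℤ)) - z * u ((c k : ℤ) - ((l.castSucc : ℕ) : ℤ)) =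
        -z * (u ((c k : ℤ) - (l : ℤ)) - y * u ((c k : ℤ) - (l : ℤ) - 1))
      rw [Fin.val_succ, Fin.val_castSucc, Nat.cast_add, Nat.cast_one, ← sub_sub]
      linear_combination (-u ((c k : ℤ) - (l : ℤ) - 1)) * hyz
    rw [h2, Matrix.det_smul, Fintype.card_fin]
    change (-1) ^ ((0 : Fin (r + 1)) : ℕ) * z ^ ((0 : Fin (r + 1)) : ℕ) * _ = _
    simp
  · intro l _
    change _ * (z ^ ((l.succ : Fin (r + 1)) : ℕ) - z * z ^ ((l.castSucc : Fin (r + 1)) : ℕ)) * _ = 0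
    rw [Fin.val_succ, Fin.val_castSucc, pow_succ' z, sub_self, mul_zero, zero_mul]

theorem schurDet_extend {r : ℕ} (mu : Fin r → ℕ) {g : ℤ → R} (h0 : g 0 = 1)
    (hneg : ∀ i < 0, g i = 0) : schurDet (extend mu) g = schurDet mu g := by
  have hlast : extend mu (Fin.last r) = 0 := Fin.snoc_last (α := fun _ => ℕ) 0 mu
  have hcast : ∀ j : Fin r, extend mu j.castSucc = mu j :=
    fun j => Fin.snoc_castSucc (α := fun _ => ℕ) 0 mu j
  rw [schurDet, Matrix.det_succ_column _ (Fin.last r), Fin.sum_univ_castSucc,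
    Finset.sum_eq_zero, zero_add, schurDet, Matrix.of_apply, hlast]
  · rw [Fin.val_last, ← two_mul, pow_mul]
    simp only [even_two, Even.neg_pow, one_pow, Nat.cast_zero, zero_sub, neg_add_cancel, h0,
      mul_one, one_mul]
    congr 1
    ext1 i j
    rw [Matrix.submatrix_apply, Fin.succAbove_last, Matrix.of_apply, Matrix.of_apply, hcast]
    rfl
  · intro i _
    rw [Matrix.of_apply, hlast, hneg, mul_zero, zero_mul]
    have := i.isLt
    rw [Fin.val_last, Fin.val_castSucc]
    omega

end Determinants

/-! ### The two factors in `R((z))` -/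

section Factors

variable {R : Type*} [CommRing R]

/-- The ring homomorphism `B_s[z⁻¹] → R((z))` given by `π : B_s → R` on coefficients. -/
def laurentEval {s : ℕ} (π : B s →+* R) : Polynomial (B s) →+* LaurentSeries R :=
  Polynomial.eval₂RingHom ((HahnSeries.C : R →+* LaurentSeries R).comp π)
    (HahnSeries.single (-1 : ℤ) (1 : R))

theorem laurentEval_C {s : ℕ} (π : B s →+* R) (p : B s) :
    laurentEval π (Polynomial.C p) = HahnSeries.C (π p) := by
  simp [laurentEval]

theorem laurentEval_X {s : ℕ} (π : B s →+* R) : laurentEval π Polynomial.X = HahnSeries.single (-1 : ℤ) 1 := by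
  simp [laurentEval]

theorem coeff_E_of_lt {s l : ℕ} (hl : s < l) : PowerSeries.coeff l (E s) = 0 := by
  rw [E, map_add, map_sum, PowerSeries.coeff_one, if_neg (by omega), zero_add]
  refine Finset.sum_eq_zero fun i _ => ?_
  rw [PowerSeries.coeff_monomial, if_neg]
  have := i.isLt
  omega

theorem single_pow_natCast (a : ℤ) (k : ℕ) :
    (HahnSeries.single a (1 : R) : LaurentSeries R) ^ k = HahnSeries.single (k * a) 1 := by
  rw [HahnSeries.single_pow, one_pow, nsmul_eq_mul]

/-- Pulling out z^s rewrites E_s(z) as the scalar of `det_border_column` at y = z⁻¹. -/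
theorem ofPowerSeries_map_E {s : ℕ} (π : B s →+* R) :
    HahnSeries.ofPowerSeries ℤ R (PowerSeries.map π (E s)) = HahnSeries.single (s : ℤ) 1 *
    ∑ l : Fin (s + 1), (HahnSeries.single (-1 : ℤ) 1) ^ (s - (l : ℕ)) *
      HahnSeries.C (π (PowerSeries.coeff (l : ℕ) (E s))) := by
  have h1 : PowerSeries.map π (E s) = ∑ l : Fin (s + 1),
      PowerSeries.C (π (PowerSeries.coeff (l : ℕ) (E s))) * PowerSeries.X ^ (l : ℕ) := by
    ext1 j
    rw [map_sum, PowerSeries.coeff_map]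
    simp_rw [PowerSeries.coeff_C_mul, PowerSeries.coeff_X_pow, mul_ite, mul_one, mul_zero]
    rw [Fin.sum_univ_eq_sum_range
      (fun l => if j = l then π (PowerSeries.coeff l (E s)) else 0), Finset.sum_ite_eq]
    split_ifs with hj
    · rfl
    · rw [coeff_E_of_lt (by simpa using hj), map_zero]
  rw [h1, map_sum, Finset.mul_sum]
  refine Finset.sum_congr rfl fun l _ => ?_
  rw [map_mul, map_pow, HahnSeries.ofPowerSeries_C, HahnSeries.ofPowerSeries_X, ← mul_assoc,
    single_pow_natCast, single_pow_natCast, HahnSeries.single_mul_single, mul_comm]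
  congr 2
  · have := l.isLt
    rw [Nat.cast_sub (by omega)]
    congr 1
    ring
  · rw [mul_one]

/-- Laplace expansion along the last column. Contraction signs are those of a first column, whence
the factor (-1)^s. -/
theorem phiInv_contract {s n : ℕ} {c : Fin (s + 1) → ℕ} (hc : ∀ k, c k < n)
    (f : B s →+* R) (y : R) :
    ∑ i ∈ Finset.range n, y ^ i * f (phiInv s (contract (beta i)
      (ExteriorAlgebra.ιMulti ℤ (s + 1) fun k => b (c k)))) =
    (-1) ^ s * Matrix.det (Matrix.of fun k : Fin (s + 1) =>
      (Fin.snoc (fun l : Fin s => f (h s ((c k : ℤ) - (l : ℤ)))) (y ^ c k) :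
        Fin (s + 1) → R)) := by
  rw [Matrix.det_succ_column _ (Fin.last s), Finset.mul_sum]
  simp_rw [contract_ιMulti, map_sum, Finset.mul_sum]
  rw [Finset.sum_comm]
  refine Finset.sum_congr rfl fun k _ => ?_
  rw [Finset.sum_eq_single_of_mem (c k) (Finset.mem_range.2 (hc k))]
  · rw [Polynomial.lcoeff_apply, coeff_b, if_pos rfl, mul_one, map_smul,
      phiInv_ιMulti_b fun j => c (k.succAbove j), map_zsmul, RingHom.map_det, Matrix.of_apply,
      Fin.snoc_last, Fin.val_last, zsmul_eq_mul, ← mul_assoc, ← mul_assoc]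
    congr 1
    · have hs : (-1 : R) ^ s * (-1) ^ s = 1 := by rw [← mul_pow]; simp
      push_cast
      rw [pow_add]
      linear_combination (-(-1) ^ (k : ℕ) * y ^ c k) * hs
    · congr 1
      ext1 i l
      simp only [Matrix.submatrix_apply, Matrix.of_apply, Fin.succAbove_last, Fin.snoc_castSucc,
        RingHom.mapMatrix_apply, Matrix.map_apply]
  · intro i _ hi
    rw [Polynomial.lcoeff_apply, coeff_b, if_neg hi, mul_zero, zero_smul, map_zero, map_zero,
      mul_zero]

theorem E_mul_schurDet {s n : ℕ} (π : B s →+* R) {lam : Fin (s + 1) → ℕ}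
    (hlam : ∀ k : Fin (s + 1), (k : ℕ) + lam k.rev < n) :
    HahnSeries.ofPowerSeries ℤ R (PowerSeries.map π (E s)) *
      schurDet lam (fun j => laurentEval π (sigmaMinusH s j)) = (-1) ^ s * (HahnSeries.single (s : ℤ) 1 *
      ∑ i ∈ Finset.range n, (HahnSeries.single (-1 : ℤ) 1) ^ i *
        HahnSeries.C (π (phiInv s (contract (beta i) (wedge lam : Ext))))) := by
  set f : B s →+* LaurentSeries R := HahnSeries.C.comp π with hf
  have hg : ∀ j, laurentEval π (sigmaMinusH s j) = bilateral ((PowerSeries.mk fun i =>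
      (HahnSeries.single (-1 : ℤ) (1 : R) : LaurentSeries R) ^ i) *
        PowerSeries.map f (invE s)) j := by
    intro j
    rw [sigmaMinusH_eq, sigmaSeq, map_bilateral, map_mul]
    congr 2
    · ext1 i
      rw [PowerSeries.coeff_map, PowerSeries.coeff_mk, PowerSeries.coeff_mk, map_pow, laurentEval_X]
    · ext1 i
      rw [PowerSeries.coeff_map, PowerSeries.coeff_map, PowerSeries.coeff_map, laurentEval_C]
      rfl
  have h1 := det_border_column (PowerSeries.map f (E s)) (PowerSeries.map f (invE s))
    (by rw [← map_mul, E_mul_invE, map_one])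
    (fun l hl => by rw [PowerSeries.coeff_map, coeff_E_of_lt hl, map_zero])
    (HahnSeries.single (-1 : ℤ) (1 : R)) (fun k => k + lam k.rev)
  have h2 := phiInv_contract (c := fun k => k + lam k.rev) hlam f
    (HahnSeries.single (-1 : ℤ) (1 : R))
  simp_rw [h_eq_bilateral, map_bilateral] at h2
  rw [← h1] at h2
  rw [wedge, exteriorPower.ιMulti_apply_coe, schurDet_eq_det, ofPowerSeries_map_E]
  simp_rw [hg]
  change _ = (-1) ^ s * (_ * ∑ i ∈ Finset.range n, _ * f _)
  rw [h2, mul_left_comm, ← mul_assoc ((-1) ^ s) ((-1) ^ s), ← mul_pow, mul_assoc]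
  simp [hf]

theorem phiInv_ι_mul {r : ℕ} (c : Fin r → ℕ) (i : ℕ) :
    phiInv (r + 1) (ExteriorAlgebra.ι ℤ (b i) *
      ExteriorAlgebra.ιMulti ℤ r fun k => b (c k)) =
    ∑ l : Fin (r + 1), (-1) ^ (l : ℕ) * h (r + 1) ((i : ℤ) - (l : ℤ)) *
      Matrix.det (Matrix.of fun k m : Fin r =>
        h (r + 1) ((c k : ℤ) - (l.succAbove m : ℤ))) := by
  have h1 : ExteriorAlgebra.ι ℤ (b i) * (ExteriorAlgebra.ιMulti ℤ r fun k => b (c k)) =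
      ExteriorAlgebra.ιMulti ℤ (r + 1)
        fun k => b ((Fin.cons i c : Fin (r + 1) → ℕ) k) := by
    rw [ExteriorAlgebra.ιMulti_succ_apply]
    rfl
  rw [h1, phiInv_ιMulti_b, Matrix.det_succ_row_zero]
  rfl

/-- Expand φ⁻¹(b_i ∧ [b]_μ) along its first row. As ∑_i h_{i-l} zⁱ = z^l / E_{r+1}(z), the
generating series is 1/E_{r+1}(z) times a determinant with first row z^l, to which `det_border_row`
applies. -/
theorem invE_mul_schurDet {r : ℕ} (π : B (r + 1) →+* R) (mu : Fin r → ℕ) :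
    HahnSeries.ofPowerSeries ℤ R (PowerSeries.map π (invE (r + 1))) *
      schurDet (extend mu) (fun j => laurentEval π (sigmaBarMinusH (r + 1) j)) =
      (-1) ^ r * (HahnSeries.single (-(r : ℤ)) 1 * HahnSeries.ofPowerSeries ℤ R
        (PowerSeries.mk fun i => π
          (phiInv (r + 1) (ExteriorAlgebra.ι ℤ (b i) * (wedge mu : Ext))))) := by
  set f : B (r + 1) →+* LaurentSeries R := HahnSeries.C.comp π
  set y : LaurentSeries R := HahnSeries.single (-1 : ℤ) 1 with hy
  set z : LaurentSeries R := HahnSeries.single (1 : ℤ) 1 with hz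
  have hyz : y * z = 1 := by
    rw [hy, hz, HahnSeries.single_mul_single]
    simp
  have hg : ∀ j, laurentEval π (sigmaBarMinusH (r + 1) j) =
      f (h (r + 1) j) - y * f (h (r + 1) (j - 1)) := by
    intro j
    rw [sigmaBarMinusH_eq, sigmaBarSeq, map_sub, map_mul, laurentEval_C,
      laurentEval_C, laurentEval_X]
    rfl
  have hdet : schurDet (extend mu) (fun j => laurentEval π (sigmaBarMinusH (r + 1) j)) = Matrix.det (Matrix.of
      fun k l : Fin r => f (h (r + 1) (((k + mu k.rev : ℕ) : ℤ) - (l : ℤ))) -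
        y * f (h (r + 1) (((k + mu k.rev : ℕ) : ℤ) - (l : ℤ) - 1))) := by
    rw [schurDet_extend, schurDet_eq_det]
    · simp_rw [hg]
    · rw [hg, h_zero, h_of_neg (by norm_num)]
      simp
    · intro i hi
      rw [hg, h_of_neg hi, h_of_neg (by omega)]
      simp
  have hPS : HahnSeries.ofPowerSeries ℤ R (PowerSeries.mk fun i =>
      π (phiInv (r + 1) (ExteriorAlgebra.ι ℤ (b i) * (wedge mu : Ext)))) =
      HahnSeries.ofPowerSeries ℤ R (PowerSeries.map π (invE (r + 1))) * Matrix.det (Matrix.of (Fin.cons (fun l => z ^ (l : ℕ))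
        (fun k l => f (h (r + 1) (((k + mu k.rev : ℕ) : ℤ) - (l : ℤ)))) :
          Fin (r + 1) → Fin (r + 1) → LaurentSeries R)) := by
    have hsum : (PowerSeries.mk fun i => π (phiInv (r + 1)
        (ExteriorAlgebra.ι ℤ (b i) * (wedge mu : Ext)))) = ∑ l : Fin (r + 1),
        (-1) ^ (l : ℕ) * (PowerSeries.X ^ (l : ℕ) *
          PowerSeries.map π (invE (r + 1))) *
          PowerSeries.C (π (Matrix.det (Matrix.of fun k m : Fin r =>
            h (r + 1) (((k + mu k.rev : ℕ) : ℤ) - (l.succAbove m : ℤ))))) := by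
      ext1 i
      rw [PowerSeries.coeff_mk, wedge, exteriorPower.ιMulti_apply_coe,
        phiInv_ι_mul (fun k : Fin r => k + mu k.rev), map_sum, map_sum]
      refine Finset.sum_congr rfl fun l _ => ?_
      have hsign : ((-1) ^ (l : ℕ) : PowerSeries (R)) =
          PowerSeries.C ((-1) ^ (l : ℕ)) := by
        rw [map_pow, map_neg, map_one]
      rw [PowerSeries.coeff_mul_C, hsign, PowerSeries.coeff_C_mul, PowerSeries.coeff_X_pow_mul',
        map_mul, map_mul, map_pow, map_neg, map_one]
      congr 2
      split_ifs with hl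
      · rw [PowerSeries.coeff_map, ← Nat.cast_sub hl, h_eq_bilateral, bilateral_natCast]
      · rw [h_of_neg (by omega), map_zero]
    rw [hsum, map_sum, Matrix.det_succ_row_zero, Finset.mul_sum]
    refine Finset.sum_congr rfl fun l _ => ?_
    rw [map_mul, map_mul, map_mul, map_pow, map_pow, map_neg, map_one, HahnSeries.ofPowerSeries_X,
      HahnSeries.ofPowerSeries_C]
    change _ * (z ^ (l : ℕ) * HahnSeries.ofPowerSeries ℤ R (PowerSeries.map π (invE (r + 1)))) * f _ = HahnSeries.ofPowerSeries ℤ R (PowerSeries.map π (invE (r + 1))) * (_ * z ^ (l : ℕ) * _)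
    rw [RingHom.map_det]
    change _ * Matrix.det (Matrix.of fun k m : Fin r =>
      f (h (r + 1) (((k + mu k.rev : ℕ) : ℤ) - (l.succAbove m : ℤ)))) = _ * (_ * Matrix.det
      (Matrix.of fun k m : Fin r =>
        f (h (r + 1) (((k + mu k.rev : ℕ) : ℤ) - (l.succAbove m : ℤ)))))
    ring
  have hyr : (HahnSeries.single (-(r : ℤ)) 1 : LaurentSeries R) = y ^ r := by
    rw [hy, single_pow_natCast]
    congr 1
    rw [mul_neg_one]
  rw [hPS, det_border_row (fun j => f (h (r + 1) j)) hyz fun k : Fin r => (k : ℕ) + mu k.rev,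
    ← hdet, hyr]
  have hone : (-1) ^ r * (y ^ r * (-z) ^ r) = 1 := by
    rw [← mul_pow, ← mul_pow]
    simp [hyz]
  linear_combination (-(HahnSeries.ofPowerSeries ℤ R (PowerSeries.map π (invE (r + 1))) * schurDet (extend mu) (fun j => laurentEval π (sigmaBarMinusH (r + 1) j)))) * hone

end Factors

/-! ### The residue -/

section Residue

variable {R S T : Type*} [CommRing R] [CommRing S] [CommRing T]

/-- A ring homomorphism acting on the coefficients of Laurent series. -/
def laurentMap (f : R →+* T) : LaurentSeries R →+* LaurentSeries T where
  toFun x := HahnSeries.map x f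
  map_one' := HahnSeries.map_one f.toMonoidWithZeroHom
  map_mul' _ _ := HahnSeries.map_mul (f : R →ₙ+* T)
  map_zero' := HahnSeries.map_zero (f : ZeroHom R T)
  map_add' _ _ := HahnSeries.map_add (f : R →+ T)

theorem coeff_laurentMap (f : R →+* T) (x : LaurentSeries R) (i : ℤ) :
    (laurentMap f x).coeff i = f (x.coeff i) := rfl

theorem laurentMap_single (f : R →+* T) (i : ℤ) (a : R) :
    laurentMap f (HahnSeries.single i a) = HahnSeries.single i (f a) :=
  HahnSeries.map_single (f : ZeroHom R T)

/-- The prefactors multiply to -z⁻¹, so the residue pairs z⁻ⁱ with zⁱ only. -/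
theorem res_laurentMap_mul (f : R →+* T) (g : S →+* T) (s n : ℕ) (x : ℕ → R) (Q : PowerSeries S) :
    res (laurentMap f ((-1) ^ s * (HahnSeries.single (s : ℤ) 1 * ∑ i ∈ Finset.range n,
        (HahnSeries.single (-1 : ℤ) 1) ^ i * HahnSeries.C (x i))) *
      laurentMap g ((-1) ^ (s + 1) * (HahnSeries.single (-((s + 1 : ℕ) : ℤ)) 1 *
        HahnSeries.ofPowerSeries ℤ S Q))) =
      -∑ i ∈ Finset.range n, f (x i) * g (PowerSeries.coeff i Q) := by
  have hx : ∀ i, (HahnSeries.single (s : ℤ) 1 : LaurentSeries R) *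
      ((HahnSeries.single (-1 : ℤ) 1) ^ i * HahnSeries.C (x i)) =
      HahnSeries.single ((s : ℤ) - i) (x i) := by
    intro i
    rw [single_pow_natCast, HahnSeries.C_apply, HahnSeries.single_mul_single,
      HahnSeries.single_mul_single, one_mul, one_mul, mul_neg_one, add_zero, ← sub_eq_add_neg]
  have hsign : ((-1) ^ s * (-1) ^ (s + 1) : LaurentSeries T) = -1 := by
    rw [pow_succ, ← mul_assoc, ← mul_pow]
    simp
  rw [Finset.mul_sum]
  simp_rw [hx]
  rw [map_mul, map_mul, map_mul, map_pow, map_pow, map_neg, map_neg, map_one, map_one, map_sum,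
    laurentMap_single]
  simp_rw [laurentMap_single]
  rw [mul_mul_mul_comm, hsign, neg_one_mul, res, HahnSeries.coeff_neg, ← mul_assoc, Finset.sum_mul,
    Finset.sum_mul, HahnSeries.coeff_sum]
  congr 1
  refine Finset.sum_congr rfl fun i _ => ?_
  rw [HahnSeries.single_mul_single, map_one, mul_one,
    show (-1 : ℤ) = (i : ℤ) + ((s : ℤ) - i + -((s + 1 : ℕ) : ℤ)) by push_cast; ring,
    HahnSeries.coeff_single_mul_add, coeff_laurentMap, LaurentSeries.coeff_coe_powerSeries]

theorem add_lt_of_mem_boundedPartitions {s n : ℕ} {lam : Fin (s + 1) → ℕ}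
    (hlam : lam ∈ boundedPartitions (s + 1) n) (k : Fin (s + 1)) : (k : ℕ) + lam k.rev < n := by
  have := (Finset.mem_filter.1 hlam).2.2 k.rev
  have := k.isLt
  omega

theorem res_sum_laurentMap_mul {s n : ℕ} (f : R →+* T) (g : S →+* T) (π : B s →+* R)
    (ρ : B (s + 2) →+* S) (a : (Fin (s + 1) → ℕ) → ℤ) :
    res (∑ lam ∈ boundedPartitions (s + 1) n, ∑ mu ∈ boundedPartitions (s + 1) n,
      (a lam * a mu) •
        (laurentMap f (HahnSeries.ofPowerSeries ℤ R (PowerSeries.map π (E s)) *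
            schurDet lam fun j => laurentEval π (sigmaMinusH s j)) *
          laurentMap g (HahnSeries.ofPowerSeries ℤ S (PowerSeries.map ρ (invE (s + 2))) *
            schurDet (extend mu) fun j => laurentEval ρ (sigmaBarMinusH (s + 2) j)))) =
      -∑ i ∈ Finset.range n,
        f (π (phiInv s (contract (beta i)
          ((∑ lam ∈ boundedPartitions (s + 1) n, a lam • wedge lam : ⋀[ℤ]^(s + 1) M0) : Ext)))) *
        g (ρ (phiInv (s + 2) (ExteriorAlgebra.ι ℤ (b i) *
          ((∑ lam ∈ boundedPartitions (s + 1) n, a lam • wedge lam : ⋀[ℤ]^(s + 1) M0) : Ext)))) := by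
  have hcoe : ((∑ lam ∈ boundedPartitions (s + 1) n, a lam • wedge lam : ⋀[ℤ]^(s + 1) M0) : Ext) =
      ∑ lam ∈ boundedPartitions (s + 1) n, a lam • (wedge lam : Ext) := by
    simp
  have hterm : ∀ lam ∈ boundedPartitions (s + 1) n, ∀ mu : Fin (s + 1) → ℕ,
      res (laurentMap f (HahnSeries.ofPowerSeries ℤ R (PowerSeries.map π (E s)) *
            schurDet lam fun j => laurentEval π (sigmaMinusH s j)) *
          laurentMap g (HahnSeries.ofPowerSeries ℤ S (PowerSeries.map ρ (invE (s + 2))) *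
            schurDet (extend mu) fun j => laurentEval ρ (sigmaBarMinusH (s + 2) j))) =
      -∑ i ∈ Finset.range n, f (π (phiInv s (contract (beta i) (wedge lam : Ext)))) *
        g (ρ (phiInv (s + 2) (ExteriorAlgebra.ι ℤ (b i) * (wedge mu : Ext)))) := by
    intro lam hlam mu
    rw [E_mul_schurDet π (add_lt_of_mem_boundedPartitions hlam), invE_mul_schurDet,
      res_laurentMap_mul]
    simp_rw [PowerSeries.coeff_mk]
  simp only [res] at hterm ⊢
  simp_rw [HahnSeries.coeff_sum, HahnSeries.coeff_smul]
  rw [Finset.sum_congr rfl fun lam hlam => Finset.sum_congr rfl fun mu _ => by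
    rw [hterm lam hlam mu, smul_neg]]
  simp_rw [Finset.sum_neg_distrib]
  congr 1
  rw [hcoe]
  simp_rw [map_sum, Finset.mul_sum, map_sum, Finset.sum_mul, Finset.mul_sum, Finset.smul_sum]
  rw [Finset.sum_congr rfl fun lam _ => Finset.sum_comm, Finset.sum_comm]
  refine Finset.sum_congr rfl fun i _ =>
    Finset.sum_congr rfl fun lam _ => Finset.sum_congr rfl fun mu _ => ?_
  rw [map_smul, map_smul, map_zsmul, map_zsmul, mul_smul_comm, map_smul, map_zsmul, map_zsmul,
    smul_mul_smul_comm]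

theorem mul_sum_laurentMap_mul {s n : ℕ} (f : R →+* T) (g : S →+* T) (π : B s →+* R)
    (ρ : B (s + 2) →+* S) (a : (Fin (s + 1) → ℕ) → ℤ) :
    laurentMap f (HahnSeries.ofPowerSeries ℤ R (PowerSeries.map π (E s))) *
        laurentMap g (HahnSeries.ofPowerSeries ℤ S (PowerSeries.map ρ (invE (s + 2)))) *
      ∑ lam ∈ boundedPartitions (s + 1) n, ∑ mu ∈ boundedPartitions (s + 1) n,
        (a lam * a mu) •
          (laurentMap f (schurDet lam fun j => laurentEval π (sigmaMinusH s j)) *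
            laurentMap g (laurentEval ρ
              (sigmaBarMinusB (s + 2) (schurDet (extend mu) (h (s + 2)))))) =
    ∑ lam ∈ boundedPartitions (s + 1) n, ∑ mu ∈ boundedPartitions (s + 1) n,
      (a lam * a mu) •
        (laurentMap f (HahnSeries.ofPowerSeries ℤ R (PowerSeries.map π (E s)) *
            schurDet lam fun j => laurentEval π (sigmaMinusH s j)) *
          laurentMap g (HahnSeries.ofPowerSeries ℤ S (PowerSeries.map ρ (invE (s + 2))) *
            schurDet (extend mu) fun j => laurentEval ρ (sigmaBarMinusH (s + 2) j))) := by
  rw [Finset.mul_sum]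
  refine Finset.sum_congr rfl fun lam _ => ?_
  rw [Finset.mul_sum]
  refine Finset.sum_congr rfl fun mu _ => ?_
  rw [mul_smul_comm, sigmaBarMinusB_schurDet, map_schurDet (laurentEval ρ)]
  simp_rw [sigmaBarMinusH_eq, map_mul]
  rw [mul_mul_mul_comm]

/-- The ring homomorphism `x ↦ x ⊗ 1`. -/
def tensorLeft (R S : Type*) [CommRing R] [CommRing S] : R →+* R ⊗[ℤ] S :=
  ((Algebra.TensorProduct.includeLeft : R →ₐ[ℤ] R ⊗[ℤ] S) : R →+* R ⊗[ℤ] S)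

/-- The ring homomorphism `y ↦ 1 ⊗ y`. -/
def tensorRight (R S : Type*) [CommRing R] [CommRing S] : S →+* R ⊗[ℤ] S :=
  ((Algebra.TensorProduct.includeRight : S →ₐ[ℤ] R ⊗[ℤ] S) : S →+* R ⊗[ℤ] S)

theorem tensorLeft_mul_tensorRight (x : R) (y : S) :
    tensorLeft R S x * tensorRight R S y = x ⊗ₜ[ℤ] y := by
  simp [tensorLeft, tensorRight]

end Residue

/-! ### The main equivalence -/

theorem supportedBelow_sum_wedge {s n : ℕ} (a : (Fin (s + 1) → ℕ) → ℤ) :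
    SupportedBelow n ((∑ lam ∈ boundedPartitions (s + 1) n, a lam • wedge lam :
      ⋀[ℤ]^(s + 1) M0) : Ext) := by
  rw [Submodule.coe_sum]
  refine SupportedBelow.sum fun lam hlam => ?_
  rw [Submodule.coe_smul, wedge, exteriorPower.ιMulti_apply_coe]
  exact (supportedBelow_ιMulti_b (c := fun k : Fin (s + 1) => (k : ℕ) + lam k.rev)
    (add_lt_of_mem_boundedPartitions hlam)).smul _

theorem SupportedBelow.contract_beta {n : ℕ} {x : Ext} (hx : SupportedBelow n x) {i : ℕ}
    (hi : n ≤ i) : SchubertDerivation.contract (beta i) x = 0 := by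
  rw [hx (beta i)]
  refine Finset.sum_eq_zero fun j hj => ?_
  rw [Finset.mem_range] at hj
  rw [Polynomial.lcoeff_apply, coeff_b, if_neg (by omega), zero_smul]

theorem SupportedBelow.ι_mul {n : ℕ} {x : Ext} (hx : SupportedBelow n x) {i : ℕ} (hi : i < n) :
    SupportedBelow n (ExteriorAlgebra.ι ℤ (b i) * x) := by
  intro f
  have h1 : ∑ j ∈ Finset.range n, f (b j) • beta j (b i) • x = f (b i) • x := by
    rw [Finset.sum_eq_single_of_mem i (Finset.mem_range.2 hi)]
    · rw [Polynomial.lcoeff_apply, coeff_b, if_pos rfl, one_smul]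
    · intro j _ hj
      rw [Polynomial.lcoeff_apply, coeff_b, if_neg hj, zero_smul, smul_zero]
  simp_rw [contract_ι_mul, smul_sub, Finset.sum_sub_distrib]
  rw [h1, hx f, Finset.mul_sum]
  simp_rw [mul_smul_comm]

/-- Computing the coordinate by successive contractions, one eventually contracts by some β_i with i
≥ n. -/
theorem chi_eq_zero_of_supportedBelow {n s : ℕ} {x : Ext} (hxs : x ∈ ⋀[ℤ]^s M0)
    (hx : SupportedBelow n x) {c : Fin s → ℕ} (hc : ¬ ∀ k, c k < n) : chi s c x = 0 := by
  induction s generalizing x with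
  | zero => exact absurd (fun k => k.elim0) hc
  | succ s ih =>
    rw [← chi_contract c hxs]
    by_cases h0 : c 0 < n
    · refine ih (contract_mem hxs) (hx.contract _) fun hcon => hc fun k => ?_
      exact Fin.cases h0 hcon k
    · rw [hx.contract_beta (not_lt.1 h0), map_zero]

/-- The Plücker tensor `∑_i φ⁻¹(β_i ⌟ x) ⊗ φ⁻¹(b_i ∧ x)` in `B_{s,n} ⊗ B_{s+2,n}`. -/
def pluckerTensor (s n : ℕ) (x : Ext) : BT s n ⊗[ℤ] BT (s + 2) n :=
  ∑ i ∈ Finset.range n, proj s n (phiInv s (contract (beta i) x)) ⊗ₜ[ℤ]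
    proj (s + 2) n (phiInv (s + 2) (ExteriorAlgebra.ι ℤ (b i) * x))

theorem sum_mul_eq_zero_of_sum_tmul {P Q I : Type*} [AddCommGroup P] [AddCommGroup Q]
    {J : Finset I} {x : I → P} {y : I → Q} (h : ∑ i ∈ J, x i ⊗ₜ[ℤ] y i = 0)
    (p : P →ₗ[ℤ] ℤ) (q : Q →ₗ[ℤ] ℤ) : ∑ i ∈ J, p (x i) * q (y i) = 0 := by
  simpa using congrArg (LinearMap.mul' ℤ ℤ ∘ₗ TensorProduct.map p q) h

/-- The Plücker criterion after truncation. Vanishing in the quotients is tested by products of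
coordinates with indices below n; all other coordinates vanish by the support condition. -/
theorem isDecomposable_iff_pluckerTensor_eq_zero {s n : ℕ} {m : ⋀[ℤ]^(s + 1) M0}
    (hm : SupportedBelow n (m : Ext)) :
    IsDecomposable m ↔ pluckerTensor s n (m : Ext) = 0 := by
  constructor
  · rintro ⟨v, hv⟩
    have hv' : ExteriorAlgebra.ιMulti ℤ (s + 1) v = (m : Ext) := congrArg Subtype.val hv
    -- The factors v_k may involve b_i with i ≥ n, so the identity is proved up to a bound on their
    -- degrees. The extra terms drop out since β_i ⌟ m = 0 for i ≥ n.
    let N := n + ∑ k, ((v k).natDegree + 1)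
    have h1 := plucker_ιMulti (n := N) v (fun k i hi => by
      apply Polynomial.coeff_eq_zero_of_natDegree_lt
      have := Finset.single_le_sum (f := fun k => (v k).natDegree + 1) (fun _ _ => Nat.zero_le _)
        (Finset.mem_univ k)
      simp only [N] at hi
      omega)
      ((proj s n).toAddMonoidHom.toIntLinearMap.comp (phiInv s))
      ((proj (s + 2) n).toAddMonoidHom.toIntLinearMap.comp (phiInv (s + 2)))
    rw [hv', ← Finset.sum_subset (s₁ := Finset.range n)
      (Finset.range_mono (Nat.le_add_right _ _))] at h1
    · exact h1
    · intro i _ hi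
      rw [hm.contract_beta (by simpa using hi), map_zero, TensorProduct.zero_tmul]
  · intro h
    obtain ⟨v, hv⟩ := exists_ιMulti_of_plucker n s m m.2 hm (by
      refine sum_smul_eq_zero_of_chi (s := s) (Finset.range n) (fun i => contract (beta i) (m : Ext))
        (fun i => contract_mem m.2) _ fun c => ?_
      have hmem : ∑ i ∈ Finset.range n, chi s c (contract (beta i) (m : Ext)) •
          (ExteriorAlgebra.ι ℤ (b i) * (m : Ext)) ∈ ⋀[ℤ]^(s + 2) M0 :=
        Submodule.sum_mem _ fun i _ => Submodule.smul_mem _ _ (ι_mul_mem m.2)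
      by_cases hc : ∀ k, c k < n
      · refine eq_zero_of_chi hmem fun d => ?_
        by_cases hd : ∀ k, d k < n
        · rw [map_sum, ← sum_mul_eq_zero_of_sum_tmul h (coordBT s n c hc)
            (coordBT (s + 2) n d hd)]
          refine Finset.sum_congr rfl fun i _ => ?_
          rw [coordBT_proj, coordBT_proj, coordB_phiInv c (contract_mem m.2),
            coordB_phiInv d (ι_mul_mem m.2), map_smul, smul_eq_mul]
        · refine chi_eq_zero_of_supportedBelow hmem (SupportedBelow.sum fun i hi => ?_) hd
          exact (hm.ι_mul (Finset.mem_range.1 hi)).smul _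
      · refine Finset.sum_eq_zero fun i _ => ?_
        rw [chi_eq_zero_of_supportedBelow (contract_mem m.2) (hm.contract _) hc, zero_smul])
    exact ⟨v, Subtype.ext hv⟩

end

end SchubertDerivation


theorem mainTheorem8 (r n : ℕ) (hr : 1 ≤ r) (a : (Fin r → ℕ) → ℤ) :
    (IsDecomposable (∑ lam ∈ boundedPartitions r n, a lam • wedge lam) ↔
      res (∑ lam ∈ boundedPartitions r n, ∑ mu ∈ boundedPartitions r n,
        (a lam * a mu) •
          tens (ET (r - 1) n * schurDet lam (sigmaMinusHT (r - 1) n))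
            (invET (r + 1) n * schurDet (extend mu) (sigmaBarMinusHT (r + 1) n))) = 0) ∧
    (IsDecomposable (∑ lam ∈ boundedPartitions r n, a lam • wedge lam) ↔
      res (left (BT (r - 1) n) (BT (r + 1) n) (ET (r - 1) n) *
          right (BT (r - 1) n) (BT (r + 1) n) (invET (r + 1) n) *
        ∑ lam ∈ boundedPartitions r n, ∑ mu ∈ boundedPartitions r n,
          (a lam * a mu) •
            (left (BT (r - 1) n) (BT (r + 1) n) (schurDet lam (sigmaMinusHT (r - 1) n)) *
              right (BT (r - 1) n) (BT (r + 1) n)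
                (toLaurent (r + 1) n
                  (sigmaBarMinusB (r + 1) (schurDet (extend mu) (h (r + 1))))))) = 0) := by
  obtain ⟨s, rfl⟩ : ∃ s, r = s + 1 := ⟨r - 1, by omega⟩
  have hiff := isDecomposable_iff_pluckerTensor_eq_zero
    (supportedBelow_sum_wedge (n := n) a)
  let f := tensorLeft (BT s n) (BT (s + 2) n)
  let g := tensorRight (BT s n) (BT (s + 2) n)
  have hP : ∀ x, pluckerTensor s n x = ∑ i ∈ Finset.range n,
      f (proj s n (phiInv s (contract (beta i) x))) *
        g (proj (s + 2) n (phiInv (s + 2) (ExteriorAlgebra.ι ℤ (b i) * x))) := fun x =>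
    Finset.sum_congr rfl fun i _ => (tensorLeft_mul_tensorRight _ _).symm
  have h1 := res_sum_laurentMap_mul (n := n) f g (proj s n) (proj (s + 2) n) a
  have h2 := mul_sum_laurentMap_mul (n := n) f g (proj s n) (proj (s + 2) n) a
  refine ⟨hiff.trans ?_, hiff.trans ?_⟩
  -- The residue is the negative of the Plücker tensor. What remains holds by definition: `tens`,
  -- `toLaurent`, `ET` and `invET` unfold to the general coefficient maps taken at the projections.
  · rw [← neg_eq_zero, hP, ← h1]
    exact Iff.rfl
  · rw [← neg_eq_zero, hP, ← h1, ← h2]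
    exact Iff.rfl
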